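/- Let $J_0(z)=\sum_{k\ge 0}\frac{(-1)^k}{(k!)^2}\left(\frac z2\right)^{2k}$ and $I_0(x)=\sum_{k\ge 0}\frac{1}{(k!)^2}\left(\frac x2\right)^{2k}$ be the Bessel and modified Bessel functions of the first kind of order $0$, let $K_0(t)=\int_0^\infty e^{-t\cosh u}\,du$ $(t>0)$ be the modified Bessel function of the second kind of order $0$, and let $\operatorname{ber}(x)=\operatorname{Re}J_0(xe^{3\pi i/4})$, $\operatorname{bei}(x)=\operatorname{Im}J_0(xe^{3\pi i/4})$ $(x\in\mathbb R)$ be the Kelvin functions. Then for all real $a$ and all $t>0$ the following four improper integrals, understood as $\lim_{R\to\infty}\int_0^R$, converge (possibly only conditionally) and $$K_0(t)\operatorname{ber}(a\sqrt t)=\int_0^\infty \frac{1}{\sqrt{1+y^2}}\,J_0\!\left(\frac{a^2}{4(1+y^2)}\right)\cosh\!\left(\frac{a^2y}{4(1+y^2)}\right)\cos(ty)\,dy,$$ $$K_0(t)\operatorname{bei}(a\sqrt t)=\int_0^\infty \frac{1}{\sqrt{1+y^2}}\,J_0\!\left(\frac{a^2}{4(1+y^2)}\right)\sinh\!\left(\frac{a^2y}{4(1+y^2)}\right)\sin(ty)\,dy,$$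 $$\frac{e^{-t}}{t}\operatorname{ber}(a\sqrt t)=\int_0^\infty \frac{y}{\sqrt{1+y^2}}\,I_0\!\left(\frac{a^2y}{4(1+y^2)}\right)\cos\!\left(\frac{a^2}{4(1+y^2)}\right)J_0(ty)\,dy,$$ $$\frac{e^{-t}}{t}\operatorname{bei}(a\sqrt t)=\int_0^\infty \frac{y}{\sqrt{1+y^2}}\,I_0\!\left(\frac{a^2y}{4(1+y^2)}\right)\sin\!\left(\frac{a^2}{4(1+y^2)}\right)J_0(ty)\,dy.$$ -/

import Mathlib

open Filter Topology MeasureTheory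

noncomputable section

/-- The Bessel function of the first kind of order zero, `J₀(z) = ∑ (-1)^k (z/2)^(2k) / (k!)²`
(an everywhere convergent power series), for a real or complex argument. -/
def besselJ0 {𝕜 : Type*} [RCLike 𝕜] (z : 𝕜) : 𝕜 :=
  ∑' k : ℕ, (-1) ^ k * (z / 2) ^ (2 * k) / ((k.factorial : 𝕜) ^ 2)

/-- The modified Bessel function of the first kind of order zero,
`I₀(x) = ∑ (x/2)^(2k) / (k!)²`. -/
def besselI0 (x : ℝ) : ℝ :=
  ∑' k : ℕ, (x / 2) ^ (2 * k) / ((k.factorial : ℝ) ^ 2)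

/-- The modified Bessel function of the second kind (Macdonald function) of order zero,
`K₀(t) = ∫_0^∞ exp(-t cosh u) du`, for `t > 0`. -/
def besselK0 (t : ℝ) : ℝ :=
  ∫ u in Set.Ioi (0 : ℝ), Real.exp (-t * Real.cosh u)

/-- The Kelvin function `ber(x) = Re J₀(x e^{3πi/4})`. -/
def kelvinBer (x : ℝ) : ℝ :=
  (besselJ0 ((x : ℂ) * Complex.exp (3 * (Real.pi : ℂ) * Complex.I / 4))).re

/-- The Kelvin function `bei(x) = Im J₀(x e^{3πi/4})`. -/
def kelvinBei (x : ℝ) : ℝ :=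
  (besselJ0 ((x : ℂ) * Complex.exp (3 * (Real.pi : ℂ) * Complex.I / 4))).im

/-- The improper integral `∫_0^∞ f(y) dy` converges (possibly only conditionally) and has
the value `v`: `f` is integrable on every `[0, R]` and `∫_0^R f(y) dy → v` as `R → ∞`. -/
def HasImproperIntegral (f : ℝ → ℝ) (v : ℝ) : Prop :=
  (∀ R : ℝ, 0 ≤ R → IntervalIntegrable f volume 0 R) ∧
    Tendsto (fun R : ℝ => ∫ y in (0 : ℝ)..R, f y) atTop (𝓝 v)

end

/-! Put `c = a²/4` and let `Dₙ(u,v) = (-1)ⁿ/(n!)² ∂ᵤⁿ (u²+v²)^{-1/2}` (`invDistDeriv`). With `ρ =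
u²+v²`, these have the generating function `∑ rⁿ Dₙ(u,v) = ρ^{-1/2} exp(ur/ρ) J₀(vr/ρ)`
(`hasSum_invDistDeriv`). At `(u,v) = (y,1)`, `r = ±c` it produces the kernels with `J₀`, `cosh`,
`sinh`; at `(1,y)`, `r = ic` it produces those with `I₀`, `cos`, `sin`.

Termwise, the transforms of `Dₙ` are multiples of a single function. Integrating by parts `n` times,
`∫₀^∞ Dₙ(y,1) cos(ty - nπ/2) dy = tⁿ/(n!)² K₀(t)` (`hasImproperIntegral_invDistDeriv_mul_cos`);
differentiating `n` times in `z`, the Hankel transform of `(z²+y²)^{-1/2}`, namely `e^{-tz}/t`,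
gives `∫₀^∞ y Dₙ(1,y) J₀(ty) dy = tⁿ/(n!)² e^{-t}/t`
(`hasImproperIntegral_mul_invDistDeriv_mul_besselJ0`). Weighting by `cⁿ cos(nπ/2)` or `cⁿ sin(nπ/2)`
and summing leaves the power series of `ber(a√t)` or `bei(a√t)`.

Only the term `n = 0` converges conditionally; the others are dominated by `bₙ/(1+y²)` with `∑ bₙ <
∞`, which justifies the interchange (`hasImproperIntegral_of_hasSum`). -/

/-! ### The function `J₀` on the real line: series, Bessel equation, bounds and decay. -/

/-- Taylor coefficients of `J₀` at the origin, odd ones included. -/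
noncomputable def besselCoeff (j : ℕ) : ℝ :=
  if Even j then (-1) ^ (j / 2) / (2 ^ j * ((j / 2).factorial : ℝ) ^ 2) else 0

theorem besselCoeff_even (k : ℕ) :
    besselCoeff (2 * k) = (-1) ^ k / (2 ^ (2 * k) * (k.factorial : ℝ) ^ 2) := by
  simp [besselCoeff]

theorem besselCoeff_odd {j : ℕ} (h : Odd j) : besselCoeff j = 0 := by
  simp [besselCoeff, h]

theorem besselCoeff_zero : besselCoeff 0 = 1 := by simp [besselCoeff]

theorem besselCoeff_succ_succ (j : ℕ) :
    ((j : ℝ) + 2) ^ 2 * besselCoeff (j + 2) = -besselCoeff j := by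
  rcases Nat.even_or_odd' j with ⟨k, rfl | rfl⟩
  · rw [show 2 * k + 2 = 2 * (k + 1) by ring, besselCoeff_even, besselCoeff_even,
      Nat.factorial_succ]
    have : (k.factorial : ℝ) ≠ 0 := by positivity
    have : (k : ℝ) + 1 ≠ 0 := by positivity
    push_cast
    field_simp
    ring
  · rw [besselCoeff_odd ⟨k, rfl⟩, besselCoeff_odd ⟨k + 1, by ring⟩]
    simp

/-- For `j = 2k` this is the estimate `(2k choose k) ≤ 4ᵏ`. It lets the exponential series majorize
everything that follows. -/
theorem abs_besselCoeff_le (j : ℕ) : |besselCoeff j| ≤ 1 / (j.factorial : ℝ) := by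
  rcases Nat.even_or_odd' j with ⟨k, rfl | rfl⟩
  · rw [besselCoeff_even, abs_div, abs_pow, abs_neg, abs_one, one_pow, abs_of_pos (by positivity)]
    apply one_div_le_one_div_of_le (by positivity)
    have h1 : Nat.centralBinom k ≤ 2 ^ (2 * k) := by
      rw [Nat.centralBinom]; exact Nat.choose_le_two_pow (2 * k) k
    have h2 := Nat.choose_mul_factorial_mul_factorial (show k ≤ 2 * k by omega)
    have h3 : (2 * k).factorial ≤ 2 ^ (2 * k) * k.factorial ^ 2 := by
      rw [← h2, show 2 * k - k = k by omega, mul_assoc, ← sq]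
      exact Nat.mul_le_mul_right _ h1
    exact_mod_cast h3
  · rw [besselCoeff_odd ⟨k, rfl⟩]
    simp

theorem summable_norm_besselJ0_term {𝕜 : Type*} [RCLike 𝕜] (z : 𝕜) :
    Summable fun j : ℕ => ‖(besselCoeff j : 𝕜) * z ^ j‖ := by
  refine Summable.of_nonneg_of_le (fun _ => norm_nonneg _) (fun j => ?_)
    (Real.summable_pow_div_factorial ‖z‖)
  rw [norm_mul, norm_pow, RCLike.norm_ofReal, div_eq_mul_one_div, mul_comm]
  exact mul_le_mul_of_nonneg_left (abs_besselCoeff_le j) (by positivity)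

theorem besselCoeff_mul_pow_even {𝕜 : Type*} [RCLike 𝕜] (z : 𝕜) (k : ℕ) :
    (besselCoeff (2 * k) : 𝕜) * z ^ (2 * k) =
      (-1) ^ k * (z / 2) ^ (2 * k) / ((k.factorial : 𝕜) ^ 2) := by
  have : (k.factorial : 𝕜) ≠ 0 := by exact_mod_cast k.factorial_ne_zero
  rw [besselCoeff_even]
  push_cast
  rw [div_pow]
  field_simp

theorem hasSum_besselJ0_even {𝕜 : Type*} [RCLike 𝕜] (z : 𝕜) :
    HasSum (fun k : ℕ => (-1) ^ k * (z / 2) ^ (2 * k) / ((k.factorial : 𝕜) ^ 2)) (besselJ0 z) := by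
  have hinj : Function.Injective fun k : ℕ => 2 * k := fun a b h => by simpa using h
  have := (summable_norm_besselJ0_term z).of_norm.comp_injective hinj
  exact (this.congr fun k => besselCoeff_mul_pow_even z k).hasSum

theorem hasSum_besselJ0 {𝕜 : Type*} [RCLike 𝕜] (z : 𝕜) :
    HasSum (fun j : ℕ => (besselCoeff j : 𝕜) * z ^ j) (besselJ0 z) := by
  have hinj : Function.Injective fun k : ℕ => 2 * k := fun a b h => by simpa using h
  have h0 : ∀ x ∉ Set.range (fun k : ℕ => 2 * k), (besselCoeff x : 𝕜) * z ^ x = 0 := by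
    intro x hx
    rcases Nat.even_or_odd' x with ⟨k, rfl | rfl⟩
    · exact absurd ⟨k, rfl⟩ hx
    · simp [besselCoeff_odd ⟨k, rfl⟩]
  rw [← hinj.hasSum_iff h0]
  simpa only [Function.comp_def, besselCoeff_mul_pow_even] using hasSum_besselJ0_even z

theorem hasDerivAt_tsum_pow {a : ℕ → ℝ} (ha : ∀ j, |a j| ≤ 1 / (j.factorial : ℝ)) (x : ℝ) :
    HasDerivAt (fun y => ∑' j : ℕ, a j * y ^ j) (∑' j : ℕ, (((j : ℝ) + 1) * a (j + 1)) * x ^ j) x := by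
  set R : ℝ := |x| + 1
  have hR : 0 < R := by positivity
  have hs : Summable fun j => a j * x ^ j := by
    refine Summable.of_norm_bounded (Real.summable_pow_div_factorial |x|) fun j => ?_
    rw [norm_mul, norm_pow, div_eq_mul_one_div, mul_comm]
    exact mul_le_mul_of_nonneg_left (ha j) (by positivity)
  have key := hasDerivAt_tsum_of_isPreconnected
    (g := fun (j : ℕ) y => a j * y ^ j) (g' := fun (j : ℕ) y => a j * (j * y ^ (j - 1)))
    -- Majorant for the differentiated series on the ball of radius `R = |x| + 1`; shifted by one
    -- index it is the exponential series of `R`.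
    (u := fun j : ℕ => (1 / (j.factorial : ℝ)) * (j * R ^ (j - 1)))
    (t := Metric.ball (0 : ℝ) R) (y₀ := x) (y := x) ?_ Metric.isOpen_ball
    (convex_ball 0 R).isPreconnected ?_ ?_ ?_ hs ?_
  · refine key.congr_deriv ?_
    have hs' : Summable fun j : ℕ => a j * (j * x ^ (j - 1)) := by
      refine Summable.of_norm_bounded (g := fun j : ℕ => (1 / (j.factorial : ℝ)) * (j * R ^ (j - 1))) ?_
        fun j => ?_
      · rw [← summable_nat_add_iff 1]
        refine (Real.summable_pow_div_factorial R).congr fun j => ?_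
        rw [Nat.factorial_succ]; push_cast
        have : (j : ℝ) + 1 ≠ 0 := by positivity
        field_simp
      · rw [norm_mul, norm_mul, norm_pow, Real.norm_natCast]
        gcongr
        · exact ha j
        · simp [R]
    rw [hs'.tsum_eq_zero_add]
    simp only [CharP.cast_eq_zero, zero_mul, mul_zero, zero_add, Nat.add_sub_cancel]
    refine tsum_congr fun j => ?_
    push_cast
    ring
  · rw [← summable_nat_add_iff 1]
    refine (Real.summable_pow_div_factorial R).congr fun j => ?_
    rw [Nat.factorial_succ]; push_cast
    have : (j : ℝ) + 1 ≠ 0 := by positivity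
    field_simp
  · intro j y _
    exact (hasDerivAt_pow j y).const_mul (a j)
  · intro j y hy
    rw [norm_mul, norm_mul, norm_pow, Real.norm_natCast]
    have : ‖y‖ ≤ R := by simpa using (Metric.mem_ball.1 hy).le
    gcongr
    exact ha j
  · simp [R]
  · simp [R]

/-- The derivative of `J₀` on the real line (that is, `-J₁`). -/
noncomputable def besselJ0' (x : ℝ) : ℝ := ∑' j : ℕ, (((j : ℝ) + 1) * besselCoeff (j + 1)) * x ^ j

theorem abs_besselCoeff_deriv_le (j : ℕ) :
    |((j : ℝ) + 1) * besselCoeff (j + 1)| ≤ 1 / (j.factorial : ℝ) := by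
  have h := abs_besselCoeff_le (j + 1)
  rw [Nat.factorial_succ] at h
  rw [abs_mul, abs_of_pos (by positivity)]
  calc ((j : ℝ) + 1) * |besselCoeff (j + 1)| ≤ ((j : ℝ) + 1) * (1 / (((j + 1) * j.factorial : ℕ) : ℝ)) := by
        gcongr
    _ = 1 / (j.factorial : ℝ) := by
        have : (j : ℝ) + 1 ≠ 0 := by positivity
        push_cast
        field_simp

theorem hasDerivAt_besselJ0 (x : ℝ) : HasDerivAt (besselJ0 : ℝ → ℝ) (besselJ0' x) x := by
  have e : (besselJ0 : ℝ → ℝ) = fun y => ∑' j : ℕ, besselCoeff j * y ^ j := by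
    funext y
    simpa using (hasSum_besselJ0 y).tsum_eq.symm
  rw [e]
  exact hasDerivAt_tsum_pow abs_besselCoeff_le x

theorem summable_of_abs_le_inv_factorial {a : ℕ → ℝ} (ha : ∀ j, |a j| ≤ 1 / (j.factorial : ℝ))
    (x : ℝ) : Summable fun j => a j * x ^ j := by
  refine Summable.of_norm_bounded (Real.summable_pow_div_factorial |x|) fun j => ?_
  rw [norm_mul, norm_pow, div_eq_mul_one_div, mul_comm]
  exact mul_le_mul_of_nonneg_left (ha j) (by positivity)

/-- Bessel's equation, from the two-step recursion of the coefficients. The undivided form keeps `x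
= 0`. -/
theorem exists_hasDerivAt_besselJ0' (x : ℝ) :
    ∃ d, HasDerivAt besselJ0' d x ∧ x * d = -besselJ0' x - x * besselJ0 x := by
  refine ⟨_, hasDerivAt_tsum_pow abs_besselCoeff_deriv_le x, ?_⟩
  have hb : ∀ j : ℕ, |((j : ℝ) + 1) * ((((j + 1 : ℕ) : ℝ) + 1) * besselCoeff (j + 1 + 1))|
      ≤ 1 / (j.factorial : ℝ) := by
    intro j
    rw [abs_mul, abs_of_pos (by positivity : (0 : ℝ) < j + 1)]
    have h := abs_besselCoeff_deriv_le (j + 1)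
    rw [Nat.factorial_succ] at h
    calc _ ≤ ((j : ℝ) + 1) * (1 / (((j + 1) * j.factorial : ℕ) : ℝ)) := by gcongr
      _ = 1 / (j.factorial : ℝ) := by
        have : (j : ℝ) + 1 ≠ 0 := by positivity
        push_cast
        field_simp
  have s1 := summable_of_abs_le_inv_factorial hb x
  have s2 := summable_of_abs_le_inv_factorial abs_besselCoeff_deriv_le x
  have s3 := summable_of_abs_le_inv_factorial abs_besselCoeff_le x
  have e : (besselJ0 x : ℝ) = ∑' j : ℕ, besselCoeff j * x ^ j := by
    simpa using (hasSum_besselJ0 x).tsum_eq.symm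
  rw [e, besselJ0', s2.tsum_eq_zero_add]
  have h1 : besselCoeff 1 = 0 := besselCoeff_odd (by decide)
  have s2' := (summable_nat_add_iff 1).2 s2
  simp only [zero_add, h1, mul_zero, zero_mul]
  rw [← tsum_mul_left, ← tsum_mul_left, ← tsum_neg, ← (s2'.neg).tsum_sub (s3.mul_left x)]
  refine tsum_congr fun j => ?_
  have := besselCoeff_succ_succ j
  push_cast
  rw [pow_succ]
  linear_combination (x * x ^ j) * this

theorem besselJ0_zero : besselJ0 (0 : ℝ) = 1 := by
  have := (hasSum_besselJ0 (0 : ℝ)).tsum_eq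
  rw [← this, tsum_eq_single 0]
  · simp [besselCoeff_zero]
  · intro j hj
    simp [hj]

theorem besselJ0'_zero : besselJ0' 0 = 0 := by
  rw [besselJ0', tsum_eq_single 0]
  · simp [besselCoeff_odd (show Odd 1 by decide)]
  · intro j hj
    simp [hj]

theorem continuous_besselJ0 : Continuous (besselJ0 : ℝ → ℝ) :=
  continuous_iff_continuousAt.2 fun x => (hasDerivAt_besselJ0 x).continuousAt

theorem continuous_besselJ0' : Continuous besselJ0' :=
  continuous_iff_continuousAt.2 fun x => by
    obtain ⟨d, hd, _⟩ := exists_hasDerivAt_besselJ0' x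
    exact hd.continuousAt

theorem hasDerivAt_besselJ0' {x : ℝ} (hx : x ≠ 0) :
    HasDerivAt besselJ0' (-besselJ0' x / x - besselJ0 x) x := by
  obtain ⟨d, hd, h⟩ := exists_hasDerivAt_besselJ0' x
  refine HasDerivAt.congr_deriv (hd) ?_
  rw [← mul_right_inj' hx, h]
  field_simp

theorem hasDerivAt_mul_besselJ0' (x : ℝ) :
    HasDerivAt (fun y => y * besselJ0' y) (-(x * besselJ0 x)) x := by
  obtain ⟨d, hd, h⟩ := exists_hasDerivAt_besselJ0' x
  refine HasDerivAt.congr_deriv ((hasDerivAt_id' x).fun_mul hd) ?_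
  linarith

/-- Energy argument: by Bessel's equation the left side has derivative `-2 J₀'²/x ≤ 0`, and its
value at `0` is `1`. -/
theorem besselJ0_sq_add_sq_le {x : ℝ} (hx : 0 ≤ x) : besselJ0 x ^ 2 + besselJ0' x ^ 2 ≤ 1 := by
  have h : AntitoneOn (fun x : ℝ => besselJ0 x ^ 2 + besselJ0' x ^ 2) (Set.Ici 0) := by
    refine antitoneOn_of_hasDerivWithinAt_nonpos (f' := fun x => -2 * besselJ0' x ^ 2 / x)
      (convex_Ici 0) ?_ ?_ ?_
    · exact ((continuous_besselJ0.pow 2).add (continuous_besselJ0'.pow 2)).continuousOn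
    · intro y hy
      rw [interior_Ici] at hy
      have hy' : y ≠ 0 := ne_of_gt hy
      refine HasDerivAt.hasDerivWithinAt ?_
      refine HasDerivAt.congr_deriv (((hasDerivAt_besselJ0 y).fun_pow 2).fun_add ((hasDerivAt_besselJ0' hy').fun_pow 2)) ?_
      field_simp
      ring
    · intro y hy
      rw [interior_Ici] at hy
      have : (0 : ℝ) < y := hy
      rw [show -2 * besselJ0' y ^ 2 / y = -(2 * besselJ0' y ^ 2 / y) by ring]
      exact neg_nonpos.2 (by positivity)
  have := h (Set.mem_Ici.2 le_rfl) (Set.mem_Ici.2 hx) hx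
  simpa [besselJ0_zero, besselJ0'_zero] using this

theorem abs_besselJ0_le {x : ℝ} (hx : 0 ≤ x) : |(besselJ0 x : ℝ)| ≤ 1 := by
  have := besselJ0_sq_add_sq_le hx
  exact abs_le_one_iff_mul_self_le_one.2 (by nlinarith [sq_nonneg (besselJ0' x)])

theorem abs_besselJ0'_le {x : ℝ} (hx : 0 ≤ x) : |besselJ0' x| ≤ 1 := by
  have := besselJ0_sq_add_sq_le hx
  exact abs_le_one_iff_mul_self_le_one.2 (by nlinarith [sq_nonneg (besselJ0 x)])

/-- The energy times `x` is not monotone, but the two lower-order corrections in `W` reduce its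
derivative to `-J₀²/(2x²)`. -/
theorem exists_besselJ0'_sq_le : ∃ C : ℝ, ∀ x : ℝ, 1 ≤ x → besselJ0' x ^ 2 ≤ C / x := by
  set W : ℝ → ℝ := fun x => x * (besselJ0 x ^ 2 + besselJ0' x ^ 2) + besselJ0 x * besselJ0' x +
    besselJ0 x ^ 2 / (2 * x) with hW
  have hd : ∀ y : ℝ, 0 < y → HasDerivAt W (-besselJ0 y ^ 2 / (2 * y ^ 2)) y := by
    intro y hy
    have hy' : y ≠ 0 := hy.ne'
    have h1 := hasDerivAt_besselJ0 y
    have h2 := hasDerivAt_besselJ0' hy'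
    refine HasDerivAt.congr_deriv ((((hasDerivAt_id' y).fun_mul ((h1.fun_pow 2).fun_add (h2.fun_pow 2))).fun_add
      (h1.fun_mul h2)).fun_add
      ((h1.fun_pow 2).fun_div ((hasDerivAt_id' y).const_mul 2) (by simpa using hy'))) ?_
    field_simp
    ring
  have h : AntitoneOn W (Set.Ici 1) := by
    refine antitoneOn_of_hasDerivWithinAt_nonpos (f' := fun y => -besselJ0 y ^ 2 / (2 * y ^ 2))
      (convex_Ici 1) ?_ ?_ ?_
    · intro y hy
      exact (hd y (lt_of_lt_of_le one_pos hy)).continuousAt.continuousWithinAt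
    · intro y hy
      rw [interior_Ici] at hy
      exact (hd y (one_pos.trans hy)).hasDerivWithinAt
    · intro y hy
      rw [neg_div]
      exact neg_nonpos.2 (by positivity)
  -- For `x ≥ 1`, `J₀J₀' ≥ -(x/2)(J₀² + J₀'²)`, so `W x ≥ (x/2) J₀'²`.
  refine ⟨2 * W 1, fun x hx => ?_⟩
  have hle := h (Set.mem_Ici.2 le_rfl) (Set.mem_Ici.2 hx) hx
  rw [le_div_iff₀ (by linarith)]
  have : 0 ≤ besselJ0 x ^ 2 / (2 * x) := by positivity
  have hWx : W x = x * (besselJ0 x ^ 2 + besselJ0' x ^ 2) + besselJ0 x * besselJ0' x +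
    besselJ0 x ^ 2 / (2 * x) := rfl
  nlinarith [sq_nonneg (besselJ0 x + besselJ0' x), sq_nonneg (besselJ0 x), sq_nonneg (besselJ0' x)]

theorem tendsto_besselJ0'_atTop : Tendsto besselJ0' atTop (𝓝 0) := by
  obtain ⟨C, hC⟩ := exists_besselJ0'_sq_le
  have h : Tendsto (fun x => besselJ0' x ^ 2) atTop (𝓝 0) := by
    refine tendsto_of_tendsto_of_tendsto_of_le_of_le' tendsto_const_nhds
      (tendsto_const_nhds.div_atTop tendsto_id) (Eventually.of_forall fun x => sq_nonneg _)
      ((eventually_ge_atTop 1).mono hC)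
  have h2 := (Real.continuous_sqrt.tendsto 0).comp h
  simp only [Function.comp_def, Real.sqrt_sq_eq_abs, Real.sqrt_zero] at h2
  exact (tendsto_zero_iff_abs_tendsto_zero _).2 h2

/-! ### Homogenized Legendre polynomials. -/

/-- The coefficients of `e^{ur} J₀(vr)` in powers of `r`: up to a factor `n!`, the homogenized
Legendre polynomials. -/
noncomputable def legendreHom (n : ℕ) (u v : ℝ) : ℝ :=
  ∑ p ∈ Finset.HasAntidiagonal.antidiagonal n, u ^ p.1 / (p.1.factorial : ℝ) * (besselCoeff p.2 * v ^ p.2)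

theorem legendreHom_zero (u v : ℝ) : legendreHom 0 u v = 1 := by
  simp [legendreHom, besselCoeff_zero]

theorem legendreHom_one (u v : ℝ) : legendreHom 1 u v = u := by
  simp [legendreHom, Finset.Nat.antidiagonal_succ, besselCoeff_zero,
    besselCoeff_odd (show Odd 1 by decide)]

/-- Bonnet's recursion. With `F = e^{ur} J₀(vr)` as a formal power series in `r`, Bessel's equation
for the second factor becomes `rF'' + F' = u(2rF' + F) - (u²+v²) rF`; the coefficient of `r^{n+1}`
is the claim. -/
theorem legendreHom_succ_succ (n : ℕ) (u v : ℝ) :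
    ((n : ℝ) + 2) ^ 2 * legendreHom (n + 2) u v =
      (2 * n + 3) * u * legendreHom (n + 1) u v - (u ^ 2 + v ^ 2) * legendreHom n u v := by
  set E : PowerSeries ℝ := PowerSeries.mk fun i => u ^ i / (i.factorial : ℝ) with hE
  set B : PowerSeries ℝ := PowerSeries.mk fun j => besselCoeff j * v ^ j with hB
  have hF : ∀ n, PowerSeries.coeff n (E * B) = legendreHom n u v := by
    intro n
    simp [PowerSeries.coeff_mul, hE, hB, legendreHom]
  have dE : PowerSeries.derivative ℝ E = PowerSeries.C u * E := by
    ext n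
    simp only [hE, PowerSeries.coeff_derivative, PowerSeries.coeff_mk, PowerSeries.coeff_C_mul,
      Nat.factorial_succ]
    have : (n : ℝ) + 1 ≠ 0 := by positivity
    push_cast
    field_simp
    ring
  have dB : PowerSeries.X * PowerSeries.derivative ℝ (PowerSeries.derivative ℝ B) +
      PowerSeries.derivative ℝ B + PowerSeries.C (v ^ 2) * (PowerSeries.X * B) = 0 := by
    ext n
    cases n with
    | zero =>
      rw [map_add, map_add, PowerSeries.coeff_derivative]
      simp [hB, besselCoeff_odd (show Odd 1 by decide)]
    | succ n =>
      simp only [hB, map_add, PowerSeries.coeff_succ_X_mul, PowerSeries.coeff_derivative,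
        PowerSeries.coeff_mk, PowerSeries.coeff_C_mul, map_zero]
      have := besselCoeff_succ_succ n
      push_cast
      linear_combination v ^ (n + 2) * this
  have dF : PowerSeries.derivative ℝ (E * B) =
      PowerSeries.C u * (E * B) + E * PowerSeries.derivative ℝ B := by
    rw [Derivation.leibniz, dE]; simp only [smul_eq_mul]; ring
  have ddF : PowerSeries.derivative ℝ (PowerSeries.derivative ℝ (E * B)) =
      PowerSeries.C u * (PowerSeries.C u * (E * B)) + 2 * (PowerSeries.C u * (E * PowerSeries.derivative ℝ B))
        + E * PowerSeries.derivative ℝ (PowerSeries.derivative ℝ B) := by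
    rw [dF, map_add, Derivation.leibniz, Derivation.leibniz, Derivation.leibniz, dE]
    simp only [smul_eq_mul, PowerSeries.derivative_C]
    ring
  have ode : PowerSeries.X * PowerSeries.derivative ℝ (PowerSeries.derivative ℝ (E * B)) +
      PowerSeries.derivative ℝ (E * B) =
      PowerSeries.C u * ((2 : PowerSeries ℝ) * (PowerSeries.X * PowerSeries.derivative ℝ (E * B)) + E * B) -
      PowerSeries.C (u ^ 2 + v ^ 2) * (PowerSeries.X * (E * B)) := by
    rw [ddF, dF]
    have : PowerSeries.C (u ^ 2 + v ^ 2) = PowerSeries.C u ^ 2 + PowerSeries.C (v ^ 2) := by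
      simp
    rw [this]
    linear_combination E * dB
  have := congrArg (PowerSeries.coeff (n + 1)) ode
  rw [show (2 : PowerSeries ℝ) = PowerSeries.C 2 from (map_ofNat PowerSeries.C 2).symm] at this
  rw [map_add, map_sub, PowerSeries.coeff_C_mul (n + 1) _ (u ^ 2 + v ^ 2)] at this
  simp only [map_add, PowerSeries.coeff_succ_X_mul, PowerSeries.coeff_derivative,
    PowerSeries.coeff_C_mul, hF] at this
  push_cast at this
  linear_combination this

theorem legendreHom_two (u v : ℝ) : legendreHom 2 u v = u ^ 2 / 2 - v ^ 2 / 4 := by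
  have := legendreHom_succ_succ 0 u v
  simp only [zero_add, legendreHom_zero, legendreHom_one] at this
  push_cast at this
  linarith

theorem legendreHom_three (u v : ℝ) : legendreHom 3 u v = u ^ 3 / 6 - u * v ^ 2 / 4 := by
  have := legendreHom_succ_succ 1 u v
  simp only [legendreHom_one, Nat.reduceAdd, legendreHom_two] at this
  push_cast at this
  linarith

/-- Differentiating `e^{ur} J₀(vr)` in `u` multiplies it by `r`. -/
theorem hasDerivAt_legendreHom_succ (n : ℕ) (u v : ℝ) :
    HasDerivAt (fun x => legendreHom (n + 1) x v) (legendreHom n u v) u := by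
  simp only [legendreHom, Finset.Nat.sum_antidiagonal_succ]
  simp only [pow_zero]
  refine HasDerivAt.const_add _ (HasDerivAt.fun_sum fun p _ => HasDerivAt.mul_const ?_ _)
  refine HasDerivAt.congr_deriv ((hasDerivAt_pow (p.1 + 1) u).div_const _) ?_
  rw [Nat.factorial_succ]
  have : (p.1 : ℝ) + 1 ≠ 0 := by positivity
  push_cast
  field_simp

theorem abs_legendreHom_le (n : ℕ) (u v : ℝ) :
    |legendreHom n u v| ≤ (|u| + |v|) ^ n / (n.factorial : ℝ) := by
  rw [(Commute.all |u| |v|).add_pow', legendreHom, Finset.sum_div]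
  refine (Finset.abs_sum_le_sum_abs _ _).trans (Finset.sum_le_sum fun p hp => ?_)
  have hn := Finset.HasAntidiagonal.mem_antidiagonal.1 hp
  have hc : ((n.choose p.1 : ℕ) : ℝ) * (p.1.factorial * p.2.factorial) = n.factorial := by
    have := Nat.add_choose_mul_factorial_mul_factorial p.1 p.2
    rw [hn] at this
    rw [← mul_assoc, Nat.choose_symm_of_eq_add hn.symm]
    exact_mod_cast this
  rw [nsmul_eq_mul, ← hc, abs_mul, abs_mul, abs_div, abs_pow, abs_pow, Nat.abs_cast]
  have hc0 : ((n.choose p.1 : ℕ) : ℝ) ≠ 0 := by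
    exact_mod_cast (Nat.choose_pos (by omega)).ne'
  calc |u| ^ p.1 / (p.1.factorial : ℝ) * (|besselCoeff p.2| * |v| ^ p.2)
      ≤ |u| ^ p.1 / (p.1.factorial : ℝ) * (1 / (p.2.factorial : ℝ) * |v| ^ p.2) := by
        gcongr
        exact abs_besselCoeff_le _
    _ = _ := by field_simp

theorem legendreHom_zero_left (n : ℕ) (v : ℝ) : legendreHom n 0 v = besselCoeff n * v ^ n := by
  rw [legendreHom, Finset.sum_eq_single (0, n)]
  · simp
  · rintro ⟨i, j⟩ h hne
    have : i ≠ 0 := by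
      rintro rfl
      simp at h
      exact hne (by simp [h])
    simp [this]
  · simp

theorem continuous_legendreHom (n : ℕ) :
    Continuous fun p : ℝ × ℝ => legendreHom n p.1 p.2 := by
  unfold legendreHom
  fun_prop

theorem hasSum_legendreHom (u v : ℝ) (r : ℂ) :
    HasSum (fun n => (legendreHom n u v : ℂ) * r ^ n)
      (Complex.exp (u * r) * besselJ0 ((v : ℂ) * r)) := by
  have h1 : HasSum (fun i : ℕ => ((u : ℂ) * r) ^ i / (i.factorial : ℂ)) (Complex.exp (u * r)) := by
    rw [Complex.exp_eq_exp_ℂ]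
    exact NormedSpace.expSeries_div_hasSum_exp _
  have h2 := hasSum_besselJ0 ((v : ℂ) * r)
  have s1 : Summable fun i : ℕ => ‖((u : ℂ) * r) ^ i / (i.factorial : ℂ)‖ :=
    NormedSpace.norm_expSeries_div_summable _
  have s2 := summable_norm_besselJ0_term ((v : ℂ) * r)
  have e : ∀ n, (legendreHom n u v : ℂ) * r ^ n = ∑ p ∈ Finset.HasAntidiagonal.antidiagonal n,
      ((u : ℂ) * r) ^ p.1 / (p.1.factorial : ℂ) * ((besselCoeff p.2 : ℂ) * ((v : ℂ) * r) ^ p.2) := by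
    intro n
    rw [legendreHom]
    push_cast
    rw [Finset.sum_mul]
    refine Finset.sum_congr rfl fun p hp => ?_
    rw [← Finset.HasAntidiagonal.mem_antidiagonal.1 hp, pow_add, mul_pow, mul_pow]
    ring
  have s3 := summable_norm_sum_mul_antidiagonal_of_summable_norm s1 s2
  have := tsum_mul_tsum_eq_tsum_sum_antidiagonal_of_summable_norm s1 s2
  rw [h1.tsum_eq] at this
  simp only [e]
  erw [h2.tsum_eq] at this
  rw [this]
  exact s3.of_norm.hasSum

/-! ### Derivatives of the inverse distance. -/

/-- `(-1)^n / (n!)²` times the `n`-th derivative in `u` of `(u² + v²)^{-1/2}`. -/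
noncomputable def invDistDeriv (n : ℕ) (u v : ℝ) : ℝ :=
  legendreHom n u v / (Real.sqrt (u ^ 2 + v ^ 2) * (u ^ 2 + v ^ 2) ^ n)

/-- The quotient rule produces exactly the right side of the recursion `legendreHom_succ_succ`. -/
theorem hasDerivAt_invDistDeriv (n : ℕ) (u v : ℝ) (h : 0 < u ^ 2 + v ^ 2) :
    HasDerivAt (fun x => invDistDeriv n x v) (-((n : ℝ) + 1) ^ 2 * invDistDeriv (n + 1) u v) u := by
  have hr : HasDerivAt (fun x : ℝ => x ^ 2 + v ^ 2) (2 * u) u := by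
    simpa using (hasDerivAt_pow 2 u).add_const (v ^ 2)
  have hs := hr.sqrt h.ne'
  have hden := hs.fun_mul (hr.fun_pow n)
  have hs0 : Real.sqrt (u ^ 2 + v ^ 2) ≠ 0 := (Real.sqrt_pos.2 h).ne'
  have hsq : Real.sqrt (u ^ 2 + v ^ 2) ^ 2 = u ^ 2 + v ^ 2 := Real.sq_sqrt h.le
  cases n with
  | zero =>
    have := (hasDerivAt_const u (1 : ℝ)).div hden (mul_ne_zero hs0 (pow_ne_zero _ h.ne'))
    simp only [invDistDeriv, legendreHom_zero, legendreHom_one, zero_add]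
    refine HasDerivAt.congr_deriv (this) ?_
    simp only [pow_zero, pow_one, mul_one, Nat.cast_zero]
    rw [hsq]
    field_simp
    ring
  | succ n =>
    have := (hasDerivAt_legendreHom_succ n u v).fun_div hden (mul_ne_zero hs0 (pow_ne_zero _ h.ne'))
    refine HasDerivAt.congr_deriv (this) ?_
    have hrec := legendreHom_succ_succ n u v
    simp only [invDistDeriv, Nat.add_sub_cancel]
    have hrec' : legendreHom (n + 2) u v = ((2 * n + 3) * u * legendreHom (n + 1) u v -
      (u ^ 2 + v ^ 2) * legendreHom n u v) / ((n : ℝ) + 2) ^ 2 := by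
      rw [← hrec]; field_simp
    rw [show n + 1 + 1 = n + 2 by ring, hrec']
    set ρ := u ^ 2 + v ^ 2
    set s := Real.sqrt ρ
    have hρ : ρ = s ^ 2 := hsq.symm
    have : (n : ℝ) + 1 + 1 ≠ 0 := by positivity
    have : (n : ℝ) + 2 ≠ 0 := by positivity
    rw [hρ]
    push_cast
    field_simp
    ring

theorem abs_invDistDeriv_le (n : ℕ) (u v : ℝ) (h : 0 < u ^ 2 + v ^ 2) :
    |invDistDeriv n u v| ≤ 2 ^ n / (n.factorial : ℝ) / Real.sqrt (u ^ 2 + v ^ 2) ^ (n + 1) := by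
  have hs0 : 0 < Real.sqrt (u ^ 2 + v ^ 2) := (Real.sqrt_pos.2 h)
  have hsq : Real.sqrt (u ^ 2 + v ^ 2) ^ 2 = u ^ 2 + v ^ 2 := Real.sq_sqrt h.le
  have hu : |u| ≤ Real.sqrt (u ^ 2 + v ^ 2) := Real.abs_le_sqrt (by nlinarith [sq_nonneg v])
  have hv : |v| ≤ Real.sqrt (u ^ 2 + v ^ 2) := Real.abs_le_sqrt (by nlinarith [sq_nonneg u])
  have h1 := abs_legendreHom_le n u v
  set ρ := u ^ 2 + v ^ 2
  set s := Real.sqrt ρ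
  have h2 : (|u| + |v|) ^ n ≤ (2 * s) ^ n := by gcongr; linarith
  rw [invDistDeriv, abs_div, abs_of_pos (by positivity : 0 < s * ρ ^ n), ← hsq,
    div_le_div_iff₀ (by positivity) (by positivity)]
  calc |legendreHom n u v| * s ^ (n + 1) ≤ ((2 * s) ^ n / (n.factorial : ℝ)) * s ^ (n + 1) := by
        gcongr; exact h1.trans (by gcongr)
    _ = _ := by rw [mul_pow]; ring

/-! ### `K₀` as the Fourier cosine integral of `(1+y²)^{-1/2}`. -/

theorem integrableOn_exp_neg_mul_cosh {t : ℝ} (ht : 0 < t) :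
    IntegrableOn (fun u => Real.exp (-t * Real.cosh u)) (Set.Ioi 0) := by
  refine Integrable.mono' (exp_neg_integrableOn_Ioi 0 ht)
    (by fun_prop : Continuous fun u => Real.exp (-t * Real.cosh u)).aestronglyMeasurable ?_
  filter_upwards [ae_restrict_mem measurableSet_Ioi] with u hu
  rw [Real.norm_of_nonneg (Real.exp_pos _).le]
  have h1 : u ≤ Real.cosh u := (Real.self_le_sinh_iff.2 (le_of_lt hu)).trans (Real.sinh_lt_cosh u).le
  exact Real.exp_le_exp.2 (by nlinarith)

theorem sinh_add_mul_I (x y : ℝ) :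
    Complex.sinh (x + y * Complex.I) =
      ((Real.sinh x * Real.cos y : ℝ) : ℂ) + ((Real.cosh x * Real.sin y : ℝ) : ℂ) * Complex.I := by
  rw [Complex.sinh_add, Complex.sinh_mul_I, Complex.cosh_mul_I]
  push_cast
  ring

theorem tendsto_integral_exp_neg_cosh_mul_sin {t : ℝ} (ht : 0 < t) :
    Tendsto (fun U => ∫ y in (0 : ℝ)..(Real.pi / 2), Real.exp (-t * (Real.cosh U * Real.sin y)))
      atTop (𝓝 0) := by
  have h := intervalIntegral.tendsto_integral_filter_of_dominated_convergence
    (a := 0) (b := Real.pi / 2) (μ := volume) (l := atTop) (f := fun _ => (0 : ℝ))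
    (F := fun U y => Real.exp (-t * (Real.cosh U * Real.sin y))) (fun _ => 1) ?_ ?_ ?_ ?_
  · simpa using h
  · refine Eventually.of_forall fun U => Continuous.aestronglyMeasurable ?_
    fun_prop
  · refine Eventually.of_forall fun U => Eventually.of_forall fun y hy => ?_
    rw [Set.uIoc_of_le (by positivity)] at hy
    rw [Real.norm_of_nonneg (Real.exp_pos _).le, Real.exp_le_one_iff]
    have : 0 ≤ Real.sin y := Real.sin_nonneg_of_nonneg_of_le_pi hy.1.le
      (by linarith [hy.2, Real.pi_pos])
    have := mul_nonneg ht.le (mul_nonneg (Real.cosh_pos U).le this)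
    linarith
  · exact intervalIntegrable_const
  · refine Eventually.of_forall fun y hy => ?_
    rw [Set.uIoc_of_le (by positivity)] at hy
    have hs : 0 < Real.sin y := Real.sin_pos_of_pos_of_lt_pi hy.1 (by linarith [hy.2, Real.pi_pos])
    have hc : Tendsto Real.cosh atTop atTop := by
      refine tendsto_atTop_mono' atTop ?_ tendsto_id
      filter_upwards [eventually_ge_atTop 0] with u hu
      exact (Real.self_le_sinh_iff.2 hu).trans (Real.sinh_lt_cosh u).le
    refine Real.tendsto_exp_atBot.comp ?_
    have := (hc.atTop_mul_const hs).const_mul_atTop_of_neg (neg_lt_zero.2 ht)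
    exact this

/-- Cauchy's theorem for `exp(it sinh s)` on the rectangle `[0,U] × [0,π/2]`: since `sinh(x + iπ/2)
= i cosh x`, the top edge carries `exp(-t cosh x)`, and the right edge is the error. -/
theorem integral_cos_sinh_sub_integral_exp_cosh (t U : ℝ) :
    |(∫ x in (0 : ℝ)..U, Real.cos (t * Real.sinh x)) - ∫ x in (0 : ℝ)..U, Real.exp (-t * Real.cosh x)|
      ≤ ∫ y in (0 : ℝ)..(Real.pi / 2), Real.exp (-t * (Real.cosh U * Real.sin y)) := by
  set f : ℂ → ℂ := fun s => Complex.exp (Complex.I * t * Complex.sinh s) with hf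
  have hd : Differentiable ℂ f := by
    intro s
    exact ((Complex.differentiable_sinh s).const_mul _).cexp
  have hrect := Complex.integral_boundary_rect_eq_zero_of_differentiableOn f 0
    (U + (Real.pi / 2 : ℝ) * Complex.I) hd.differentiableOn
  have re1 : (U + (Real.pi / 2 : ℝ) * Complex.I : ℂ).re = U := by simp
  have im1 : (U + (Real.pi / 2 : ℝ) * Complex.I : ℂ).im = Real.pi / 2 := by simp
  rw [re1, im1, Complex.zero_re, Complex.zero_im] at hrect
  have hfc : Continuous f := hd.continuous
  have e0 : ∀ x y : ℝ, f (x + y * Complex.I) = Complex.exp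
      (((-t * (Real.cosh x * Real.sin y) : ℝ) : ℂ) + ((t * (Real.sinh x * Real.cos y) : ℝ) : ℂ) * Complex.I) := by
    intro x y
    rw [hf]
    simp only
    rw [sinh_add_mul_I]
    congr 1
    push_cast
    linear_combination (t * (Complex.cosh x * Complex.sin y)) * Complex.I_sq
  have r1 : (∫ x in (0 : ℝ)..U, f (x + (0 : ℝ) * Complex.I)).re =
      ∫ x in (0 : ℝ)..U, Real.cos (t * Real.sinh x) := by
    have := (Complex.reCLM.intervalIntegral_comp_comm (μ := volume) (a := 0) (b := U)
      (f := fun x : ℝ => f (x + (0 : ℝ) * Complex.I))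
      (Continuous.intervalIntegrable (by fun_prop) _ _))
    simp only [Complex.reCLM_apply] at this
    rw [← this]
    congr 1
    funext x
    rw [e0, Real.sin_zero, Real.cos_zero, mul_one, mul_zero, mul_zero, Complex.ofReal_zero, zero_add,
      Complex.exp_ofReal_mul_I_re]
  have r2 : (∫ x in (0 : ℝ)..U, f (x + (Real.pi / 2 : ℝ) * Complex.I)) =
      ((∫ x in (0 : ℝ)..U, Real.exp (-t * Real.cosh x) : ℝ) : ℂ) := by
    rw [← intervalIntegral.integral_ofReal]
    congr 1
    funext x
    rw [e0]
    simp
  -- The integral along the left edge is real, so after the factor `i` it drops out of the real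
  -- part.
  have r3 : (∫ y in (0 : ℝ)..(Real.pi / 2), f ((0 : ℝ) + y * Complex.I)) =
      ((∫ y in (0 : ℝ)..(Real.pi / 2), Real.exp (-t * Real.sin y) : ℝ) : ℂ) := by
    rw [← intervalIntegral.integral_ofReal]
    congr 1
    funext x
    rw [e0]
    simp
  have r4 : ‖∫ y in (0 : ℝ)..(Real.pi / 2), f (U + y * Complex.I)‖ ≤
      ∫ y in (0 : ℝ)..(Real.pi / 2), Real.exp (-t * (Real.cosh U * Real.sin y)) := by
    refine (intervalIntegral.norm_integral_le_integral_norm (by positivity)).trans (le_of_eq ?_)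
    congr 1
    funext y
    rw [e0, Complex.norm_exp, Complex.add_re, Complex.ofReal_re, Complex.re_ofReal_mul, Complex.I_re,
      mul_zero, add_zero]
  have hre := congrArg Complex.re hrect
  rw [r2, r3] at hre
  simp only [Complex.sub_re, Complex.add_re, r1, smul_eq_mul, Complex.mul_re, Complex.I_re,
    Complex.I_im, Complex.ofReal_re, Complex.ofReal_im, zero_mul, one_mul, Complex.zero_re,
    zero_sub, sub_zero, mul_zero] at hre
  refine le_trans ?_ r4
  refine le_trans (le_of_eq ?_) (Complex.abs_im_le_norm _)
  congr 1
  linarith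

theorem tendsto_integral_cos_sinh {t : ℝ} (ht : 0 < t) :
    Tendsto (fun U => ∫ x in (0 : ℝ)..U, Real.cos (t * Real.sinh x)) atTop (𝓝 (besselK0 t)) := by
  have h1 := intervalIntegral_tendsto_integral_Ioi 0 (integrableOn_exp_neg_mul_cosh ht) tendsto_id
  have h2 := squeeze_zero_norm (fun U => (Real.norm_eq_abs _).trans_le (integral_cos_sinh_sub_integral_exp_cosh t U))
    (tendsto_integral_exp_neg_cosh_mul_sin ht)
  have := h2.add h1
  simpa [besselK0] using this

theorem integral_cos_div_sqrt (t R : ℝ) :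
    ∫ y in (0 : ℝ)..R, (Real.sqrt (1 + y ^ 2))⁻¹ * Real.cos (t * y) =
      ∫ x in (0 : ℝ)..(Real.arsinh R), Real.cos (t * Real.sinh x) := by
  have hc : Continuous fun y : ℝ => (Real.sqrt (1 + y ^ 2))⁻¹ :=
    Continuous.inv₀ (by fun_prop) fun y => (Real.sqrt_pos.2 (by positivity)).ne'
  have := intervalIntegral.integral_comp_mul_deriv (a := 0) (b := R)
    (g := fun x => Real.cos (t * Real.sinh x)) (fun x _ => Real.hasDerivAt_arsinh x)
    hc.continuousOn (by fun_prop)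
  rw [Real.arsinh_zero] at this
  rw [← this]
  congr 1
  funext y
  simp [mul_comm]

theorem tendsto_arsinh_atTop : Tendsto Real.arsinh atTop atTop :=
  Real.sinhOrderIso.symm.tendsto_atTop

theorem hasImproperIntegral_cos_div_sqrt {t : ℝ} (ht : 0 < t) :
    HasImproperIntegral (fun y => (Real.sqrt (1 + y ^ 2))⁻¹ * Real.cos (t * y)) (besselK0 t) := by
  have hc : Continuous fun y : ℝ => (Real.sqrt (1 + y ^ 2))⁻¹ :=
    Continuous.inv₀ (by fun_prop) fun y => (Real.sqrt_pos.2 (by positivity)).ne'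
  refine ⟨fun R _ => (hc.mul (by fun_prop)).intervalIntegrable _ _, ?_⟩
  simp only [integral_cos_div_sqrt]
  exact (tendsto_integral_cos_sinh ht).comp tendsto_arsinh_atTop

/-! ### Calculus of improper integrals and termwise integration. -/

theorem HasImproperIntegral.unique {f : ℝ → ℝ} {v w : ℝ} (hv : HasImproperIntegral f v)
    (hw : HasImproperIntegral f w) : v = w :=
  tendsto_nhds_unique hv.2 hw.2

theorem HasImproperIntegral.congr {f g : ℝ → ℝ} {v w : ℝ} (h : HasImproperIntegral f v)
    (hfg : f = g) (hvw : v = w) : HasImproperIntegral g w := hfg ▸ hvw ▸ h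

theorem hasImproperIntegral_of_integrableOn {f : ℝ → ℝ} (hf : IntegrableOn f (Set.Ioi 0)) :
    HasImproperIntegral f (∫ y in Set.Ioi 0, f y) :=
  ⟨fun _ hR => (intervalIntegrable_iff_integrableOn_Ioc_of_le hR).2
    (hf.mono_set Set.Ioc_subset_Ioi_self),
    intervalIntegral_tendsto_integral_Ioi 0 hf tendsto_id⟩

theorem HasImproperIntegral.add {f g : ℝ → ℝ} {v w : ℝ} (hf : HasImproperIntegral f v)
    (hg : HasImproperIntegral g w) : HasImproperIntegral (fun y => f y + g y) (v + w) := by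
  refine ⟨fun R hR => (hf.1 R hR).add (hg.1 R hR), (hf.2.add hg.2).congr' ?_⟩
  filter_upwards [eventually_ge_atTop 0] with R hR
  exact (intervalIntegral.integral_add (hf.1 R hR) (hg.1 R hR)).symm

theorem HasImproperIntegral.const_mul {f : ℝ → ℝ} {v : ℝ} (hf : HasImproperIntegral f v) (c : ℝ) :
    HasImproperIntegral (fun y => c * f y) (c * v) := by
  refine ⟨fun R hR => (hf.1 R hR).const_mul c, (hf.2.const_mul c).congr fun R => ?_⟩
  rw [intervalIntegral.integral_const_mul]

theorem integrableOn_of_abs_le_div {f : ℝ → ℝ} (hf : Continuous f) {b : ℝ}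
    (hb : ∀ y, 0 < y → |f y| ≤ b * (1 + y ^ 2)⁻¹) : IntegrableOn f (Set.Ioi 0) := by
  refine Integrable.mono' (integrable_inv_one_add_sq.integrableOn.const_mul b)
    hf.aestronglyMeasurable ?_
  filter_upwards [ae_restrict_mem measurableSet_Ioi] with y hy
  exact hb y hy

/-- Term-by-term improper integration when all terms but the first are absolutely integrable with
a summable majorant. -/
theorem hasImproperIntegral_of_hasSum {f : ℕ → ℝ → ℝ} {F : ℝ → ℝ} {v : ℕ → ℝ} {V : ℝ} {b : ℕ → ℝ}
    (hF : ∀ y, 0 < y → HasSum (fun n => f n y) (F y)) (hV : HasSum v V)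
    (hf : ∀ n, HasImproperIntegral (f n) (v n)) (hc : ∀ n, Continuous (f (n + 1)))
    (hs : Summable b) (hb : ∀ n y, 0 < y → |f (n + 1) y| ≤ b n * (1 + y ^ 2)⁻¹) :
    HasImproperIntegral F V := by
  have hint : ∀ n, IntegrableOn (f (n + 1)) (Set.Ioi 0) := fun n =>
    integrableOn_of_abs_le_div (hc n) (hb n)
  have hsum : Summable fun n => ∫ y in Set.Ioi 0, ‖f (n + 1) y‖ := by
    refine Summable.of_nonneg_of_le (fun n => integral_nonneg fun _ => norm_nonneg _) (fun n => ?_)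
      (hs.mul_right (∫ y in Set.Ioi (0 : ℝ), (1 + y ^ 2)⁻¹))
    rw [← integral_const_mul]
    refine setIntegral_mono_on (hint n).norm (integrable_inv_one_add_sq.integrableOn.const_mul _)
      measurableSet_Ioi fun y hy => hb n y hy
  have hS := hasSum_integral_of_summable_integral_norm hint hsum
  have hval : ∀ n, ∫ y in Set.Ioi 0, f (n + 1) y = v (n + 1) := fun n =>
    (hasImproperIntegral_of_integrableOn (hint n)).unique (hf (n + 1))
  simp only [hval] at hS
  have hVt : V = v 0 + ∫ y in Set.Ioi 0, ∑' n, f (n + 1) y := by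
    rw [← hS.tsum_eq, ← hV.tsum_eq, hV.summable.tsum_eq_zero_add]
  have hF' : ∀ y, 0 < y → HasSum (fun n => f (n + 1) y) (F y - f 0 y) := fun y hy => by
    simpa using (hasSum_nat_add_iff' 1).2 (hF y hy)
  have hbd : ∀ y, 0 < y → |F y - f 0 y| ≤ (∑' n, b n) * (1 + y ^ 2)⁻¹ := by
    intro y hy
    rw [← (hF' y hy).tsum_eq, ← tsum_mul_right]
    exact tsum_of_norm_bounded (f := fun n => f (n + 1) y) (hs.mul_right _).hasSum fun n => hb n y hy
  have hi : IntegrableOn (fun y => F y - f 0 y) (Set.Ioi 0) := by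
    refine Integrable.mono' (integrable_inv_one_add_sq.integrableOn.const_mul (∑' n, b n)) ?_ ?_
    -- No regularity of `F` is assumed: measurability comes from `F - f 0` being the pointwise limit
    -- of continuous partial sums.
    · refine aestronglyMeasurable_of_tendsto_ae atTop
        (f := fun N y => ∑ n ∈ Finset.range N, f (n + 1) y)
        (fun N => (continuous_finsetSum _ fun n _ => hc n).aestronglyMeasurable) ?_
      filter_upwards [ae_restrict_mem measurableSet_Ioi] with y hy
      exact (hF' y hy).tendsto_sum_nat
    · filter_upwards [ae_restrict_mem measurableSet_Ioi] with y hy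
      exact hbd y hy
  have h1 := hasImproperIntegral_of_integrableOn hi
  have h2 := (hf 0).add h1
  refine h2.congr (by funext y; ring) ?_
  rw [hVt, setIntegral_congr_fun measurableSet_Ioi fun y hy => (hF' y hy).tsum_eq]

/-! ### Cosine transforms of the inverse distance derivatives. -/

theorem continuous_invDistDeriv_left (n : ℕ) : Continuous fun y => invDistDeriv n y 1 := by
  unfold invDistDeriv
  refine Continuous.div ?_ (by fun_prop) fun y => ?_
  · exact (continuous_legendreHom n).comp (continuous_id.prodMk continuous_const)
  · have : 0 < y ^ 2 + (1 : ℝ) ^ 2 := by positivity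
    exact mul_ne_zero (Real.sqrt_pos.2 this).ne' (pow_ne_zero _ this.ne')

theorem continuous_invDistDeriv_right (n : ℕ) {z : ℝ} (hz : 0 < z) :
    Continuous fun y => invDistDeriv n z y := by
  unfold invDistDeriv
  refine Continuous.div ?_ (by fun_prop) fun y => ?_
  · exact (continuous_legendreHom n).comp (continuous_const.prodMk continuous_id)
  · have : 0 < z ^ 2 + y ^ 2 := by positivity
    exact mul_ne_zero (Real.sqrt_pos.2 this).ne' (pow_ne_zero _ this.ne')

theorem tendsto_invDistDeriv_left (n : ℕ) : Tendsto (fun y => invDistDeriv n y 1) atTop (𝓝 0) := by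
  have hs : Tendsto (fun y : ℝ => Real.sqrt (y ^ 2 + 1 ^ 2) ^ (n + 1)) atTop atTop := by
    refine (tendsto_pow_atTop n.succ_ne_zero).comp (tendsto_atTop_mono (fun y => ?_) tendsto_id)
    exact Real.le_sqrt_of_sq_le (by simp)
  refine squeeze_zero_norm (fun y => ?_) (tendsto_const_nhds.div_atTop hs
    (a := 2 ^ n / (n.factorial : ℝ)))
  exact abs_invDistDeriv_le n y 1 (by positivity)

/-- The boundary term at `y = 0` in the integration by parts below: the cosine vanishes for even
`n`, the odd Taylor coefficient of `J₀` for odd `n`. -/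
theorem cos_nat_mul_pi_div_two_mul_invDistDeriv (n : ℕ) :
    invDistDeriv n 0 1 * Real.cos (-(((n + 1 : ℕ) : ℝ) * (Real.pi / 2))) = 0 := by
  rcases Nat.even_or_odd' n with ⟨k, rfl | rfl⟩
  · have : Real.cos (-(((2 * k + 1 : ℕ) : ℝ) * (Real.pi / 2))) = 0 := by
      rw [Real.cos_neg, Real.cos_eq_zero_iff]
      exact ⟨k, by push_cast; ring⟩
    rw [this, mul_zero]
  · rw [invDistDeriv, legendreHom_zero_left, besselCoeff_odd ⟨k, rfl⟩]
    simp

/-- Each integration by parts gains `t/(n+1)²` and shifts the phase by `π/2`; both boundary terms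
vanish. -/
theorem hasImproperIntegral_invDistDeriv_mul_cos {t : ℝ} (ht : 0 < t) (n : ℕ) :
    HasImproperIntegral (fun y => invDistDeriv n y 1 * Real.cos (t * y - n * (Real.pi / 2)))
      (t ^ n / (n.factorial : ℝ) ^ 2 * besselK0 t) := by
  induction n with
  | zero =>
    refine (hasImproperIntegral_cos_div_sqrt ht).congr ?_ (by simp)
    funext y
    simp [invDistDeriv, legendreHom_zero, add_comm]
  | succ n ih =>
    have hc : ∀ m : ℕ, Continuous fun y : ℝ => Real.cos (t * y - m * (Real.pi / 2)) := fun m => by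
      fun_prop
    refine ⟨fun R _ => ((continuous_invDistDeriv_left _).mul (hc (n + 1))).intervalIntegrable _ _, ?_⟩
    have hn : ((n : ℝ) + 1) ^ 2 ≠ 0 := by positivity
    have hparts : ∀ R : ℝ, ∫ y in (0 : ℝ)..R, invDistDeriv (n + 1) y 1 *
        Real.cos (t * y - (n + 1 : ℕ) * (Real.pi / 2)) =
        (1 / ((n : ℝ) + 1) ^ 2) *
          (t * (∫ y in (0 : ℝ)..R, invDistDeriv n y 1 * Real.cos (t * y - n * (Real.pi / 2))) -
            invDistDeriv n R 1 * Real.cos (t * R - (n + 1 : ℕ) * (Real.pi / 2))) := by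
      intro R
      have hv : ∀ y : ℝ, HasDerivAt (fun y => Real.cos (t * y - (n + 1 : ℕ) * (Real.pi / 2)))
          (t * Real.cos (t * y - n * (Real.pi / 2))) y := by
        intro y
        have h1 : HasDerivAt (fun y : ℝ => t * y - (n + 1 : ℕ) * (Real.pi / 2)) t y := by
          simpa using ((hasDerivAt_id' y).const_mul t).sub_const ((n + 1 : ℕ) * (Real.pi / 2))
        refine h1.cos.congr_deriv ?_
        have : t * y - ((n + 1 : ℕ) : ℝ) * (Real.pi / 2) =
            (t * y - n * (Real.pi / 2)) - Real.pi / 2 := by push_cast; ring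
        rw [this, Real.sin_sub_pi_div_two]
        ring
      have key := intervalIntegral.integral_mul_deriv_eq_deriv_mul (a := 0) (b := R)
        (fun y _ => hasDerivAt_invDistDeriv n y 1 (by positivity)) (fun y _ => hv y)
        ((continuous_const.mul (continuous_invDistDeriv_left (n + 1))).intervalIntegrable _ _)
        ((continuous_const.mul (hc n)).intervalIntegrable _ _)
      have h0 := cos_nat_mul_pi_div_two_mul_invDistDeriv n
      rw [mul_zero, zero_sub, h0, sub_zero] at key
      have e1 : (∫ y in (0 : ℝ)..R, invDistDeriv n y 1 * (t * Real.cos (t * y - n * (Real.pi / 2)))) =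
          t * ∫ y in (0 : ℝ)..R, invDistDeriv n y 1 * Real.cos (t * y - n * (Real.pi / 2)) := by
        rw [← intervalIntegral.integral_const_mul]
        congr 1; funext y; ring
      have e2 : (∫ y in (0 : ℝ)..R, -((n : ℝ) + 1) ^ 2 * invDistDeriv (n + 1) y 1 *
          Real.cos (t * y - (n + 1 : ℕ) * (Real.pi / 2))) =
          -((n : ℝ) + 1) ^ 2 * ∫ y in (0 : ℝ)..R, invDistDeriv (n + 1) y 1 *
          Real.cos (t * y - (n + 1 : ℕ) * (Real.pi / 2)) := by
        rw [← intervalIntegral.integral_const_mul]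
        congr 1; funext y; ring
      rw [e1, e2] at key
      rw [key]
      field_simp
      ring_nf
    simp only [hparts]
    have hb : Tendsto (fun R => invDistDeriv n R 1 * Real.cos (t * R - (n + 1 : ℕ) * (Real.pi / 2)))
        atTop (𝓝 0) := by
      refine squeeze_zero_norm (fun y => ?_) (tendsto_norm_zero.comp (tendsto_invDistDeriv_left n))
      rw [norm_mul]
      exact mul_le_of_le_one_right (norm_nonneg _) (Real.abs_cos_le_one _)
    have := ((ih.2.const_mul t).sub hb).const_mul (1 / ((n : ℝ) + 1) ^ 2)
    convert this using 2
    rw [Nat.factorial_succ]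
    push_cast
    field_simp
    ring

/-! ### Hankel transforms of the inverse distance derivatives. -/

/-- Uniformity in `z ≥ ε` is what differentiation under the integral sign in `z` needs. -/
theorem abs_mul_invDistDeriv_le (n : ℕ) {ε z y : ℝ} (hε : 0 < ε) (hz : ε ≤ z) (hy : 0 ≤ y) :
    |y * invDistDeriv (n + 2) z y| ≤
      2 ^ (n + 2) / ((n + 2).factorial : ℝ) * ((1 + 1 / ε ^ 2) / ε ^ n) * (1 + y ^ 2)⁻¹ := by
  have hz0 : 0 < z := hε.trans_le hz
  have hρ : 0 < z ^ 2 + y ^ 2 := by positivity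
  have h := abs_invDistDeriv_le (n + 2) z y hρ
  have hs0 : 0 < Real.sqrt (z ^ 2 + y ^ 2) := (Real.sqrt_pos.2 hρ)
  have hsq : Real.sqrt (z ^ 2 + y ^ 2) ^ 2 = z ^ 2 + y ^ 2 := Real.sq_sqrt hρ.le
  set s := Real.sqrt (z ^ 2 + y ^ 2)
  have hys : y ≤ s := by nlinarith
  have hεs : ε ≤ s := by nlinarith
  have hs2 : 1 + y ^ 2 ≤ (1 + 1 / ε ^ 2) * s ^ 2 := by
    have h1 : ε ^ 2 ≤ z ^ 2 := by gcongr
    rw [hsq]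
    have : (1 / ε ^ 2) * ε ^ 2 = 1 := by field_simp
    have h2 : 0 ≤ 1 / ε ^ 2 := by positivity
    nlinarith [mul_le_mul_of_nonneg_left h1 h2, mul_nonneg h2 (sq_nonneg y), sq_nonneg z]
  have h3 : 1 / s ^ 2 ≤ (1 + 1 / ε ^ 2) * (1 + y ^ 2)⁻¹ := by
    rw [← div_eq_mul_inv, div_le_div_iff₀ (by positivity) (by positivity)]
    linarith
  have h4 : 1 / s ^ n ≤ 1 / ε ^ n := by gcongr
  rw [abs_mul, abs_of_nonneg hy]
  calc y * |invDistDeriv (n + 2) z y|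
      ≤ s * (2 ^ (n + 2) / ((n + 2).factorial : ℝ) / s ^ (n + 2 + 1)) := by gcongr
    _ = 2 ^ (n + 2) / ((n + 2).factorial : ℝ) * ((1 / s ^ n) * (1 / s ^ 2)) := by
        field_simp
        ring
    _ ≤ 2 ^ (n + 2) / ((n + 2).factorial : ℝ) *
        ((1 / ε ^ n) * ((1 + 1 / ε ^ 2) * (1 + y ^ 2)⁻¹)) := by gcongr
    _ = _ := by ring

theorem abs_mul_besselJ0_le {x y : ℝ} (a : ℝ) (hx : 0 ≤ x) (h : |a| ≤ y) :
    |a * besselJ0 x| ≤ y := by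
  rw [abs_mul]
  calc |a| * |besselJ0 x| ≤ |a| * 1 := by gcongr; exact abs_besselJ0_le hx
    _ ≤ y := by simpa using h

/-- The integrals `∫₀^∞ y ∂_zⁿ(z² + y²)^{-1/2} J₀(ty) dy`, up to normalization. -/
noncomputable def hankelInvDist (n : ℕ) (t z : ℝ) : ℝ :=
  ∫ y in Set.Ioi (0 : ℝ), y * invDistDeriv n z y * besselJ0 (t * y)

theorem continuous_hankelInvDist_integrand (n : ℕ) (t : ℝ) {z : ℝ} (hz : 0 < z) :
    Continuous fun y => y * invDistDeriv n z y * besselJ0 (t * y) :=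
  (continuous_id.mul (continuous_invDistDeriv_right n hz)).mul
    (continuous_besselJ0.comp (continuous_const.mul continuous_id))

theorem invDistDeriv_zero (z y : ℝ) : invDistDeriv 0 z y = 1 / Real.sqrt (z ^ 2 + y ^ 2) := by
  simp [invDistDeriv, legendreHom_zero]

theorem invDistDeriv_one (z y : ℝ) :
    invDistDeriv 1 z y = z / (Real.sqrt (z ^ 2 + y ^ 2) * (z ^ 2 + y ^ 2)) := by
  simp [invDistDeriv, legendreHom_one]

/-- The general bound `abs_invDistDeriv_le` would only give decay `1/y` here; the numerator being
`z` alone gains one more power. -/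
theorem abs_mul_invDistDeriv_one_le {z y : ℝ} (hz : 0 < z) (hy : 0 ≤ y) :
    |y * invDistDeriv 1 z y| ≤ z * (1 + 1 / z ^ 2) * (1 + y ^ 2)⁻¹ := by
  have hρ : 0 < z ^ 2 + y ^ 2 := by positivity
  have hs0 : 0 < Real.sqrt (z ^ 2 + y ^ 2) := (Real.sqrt_pos.2 hρ)
  have hys : y ≤ Real.sqrt (z ^ 2 + y ^ 2) := Real.le_sqrt_of_sq_le (by nlinarith)
  rw [invDistDeriv_one, abs_of_nonneg (by positivity)]
  set s := Real.sqrt (z ^ 2 + y ^ 2)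
  have h3 : 1 / (z ^ 2 + y ^ 2) ≤ (1 + 1 / z ^ 2) * (1 + y ^ 2)⁻¹ := by
    rw [← div_eq_mul_inv, div_le_div_iff₀ (by positivity) (by positivity)]
    have : (1 / z ^ 2) * z ^ 2 = 1 := by field_simp
    have h2 : 0 ≤ 1 / z ^ 2 := by positivity
    nlinarith [mul_nonneg h2 (sq_nonneg y), sq_nonneg z]
  calc y * (z / (s * (z ^ 2 + y ^ 2))) ≤ s * (z / (s * (z ^ 2 + y ^ 2))) := by gcongr
    _ = z * (1 / (z ^ 2 + y ^ 2)) := by field_simp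
    _ ≤ z * ((1 + 1 / z ^ 2) * (1 + y ^ 2)⁻¹) := by gcongr
    _ = _ := by ring

theorem integrableOn_hankelInvDist (n : ℕ) {t z : ℝ} (ht : 0 < t) (hz : 0 < z) :
    IntegrableOn (fun y => y * invDistDeriv (n + 1) z y * besselJ0 (t * y)) (Set.Ioi 0) := by
  cases n with
  | zero =>
    exact integrableOn_of_abs_le_div (continuous_hankelInvDist_integrand _ t hz) fun y hy =>
      abs_mul_besselJ0_le _ (by positivity) (abs_mul_invDistDeriv_one_le hz hy.le)
  | succ n =>
    exact integrableOn_of_abs_le_div (continuous_hankelInvDist_integrand _ t hz) fun y hy =>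
      abs_mul_besselJ0_le _ (by positivity) (abs_mul_invDistDeriv_le n hz le_rfl hy.le)

theorem hasDerivAt_hankelInvDist (n : ℕ) {t z : ℝ} (ht : 0 < t) (hz : 0 < z) :
    HasDerivAt (hankelInvDist (n + 1) t) (-((n : ℝ) + 2) ^ 2 * hankelInvDist (n + 2) t z) z := by
  have hε : 0 < z / 2 := by positivity
  have key := (hasDerivAt_integral_of_dominated_loc_of_deriv_le
    -- On `w > z/2` the majorant with `ε = z/2` is independent of `w`.
    (μ := volume.restrict (Set.Ioi (0 : ℝ))) (s := Set.Ioi (z / 2)) (x₀ := z)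
    (F := fun z y => y * invDistDeriv (n + 1) z y * besselJ0 (t * y))
    (F' := fun z y => -((n : ℝ) + 2) ^ 2 * (y * invDistDeriv (n + 2) z y * besselJ0 (t * y)))
    (bound := fun y => ((n : ℝ) + 2) ^ 2 * (2 ^ (n + 2) / ((n + 2).factorial : ℝ) *
      ((1 + 1 / (z / 2) ^ 2) / (z / 2) ^ n) * (1 + y ^ 2)⁻¹))
    (Ioi_mem_nhds (by linarith)) ?_ (integrableOn_hankelInvDist n ht hz) ?_ ?_ ?_ ?_).2
  · rw [integral_const_mul] at key
    exact key
  · filter_upwards [Ioi_mem_nhds hz] with w hw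
    exact (continuous_hankelInvDist_integrand _ t hw).aestronglyMeasurable
  · exact (continuous_const.mul (continuous_hankelInvDist_integrand _ t hz)).aestronglyMeasurable
  · filter_upwards [ae_restrict_mem measurableSet_Ioi] with y hy w hw
    have hy : 0 < y := hy
    rw [norm_mul, norm_neg, Real.norm_of_nonneg (by positivity)]
    gcongr
    exact abs_mul_besselJ0_le _ (by positivity)
      (abs_mul_invDistDeriv_le n hε (le_of_lt hw) hy.le)
  · exact (integrable_inv_one_add_sq.integrableOn.const_mul _).const_mul _
  · filter_upwards [ae_restrict_mem measurableSet_Ioi] with y hy w hw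
    have hw : 0 < w := hε.trans hw
    refine (((hasDerivAt_invDistDeriv (n + 1) w y (by positivity)).const_mul y).mul_const
      (besselJ0 (t * y))).congr_deriv ?_
    push_cast
    ring

theorem hasImproperIntegral_of_hasDerivAt {F f : ℝ → ℝ} {l : ℝ} (hF : ∀ y, HasDerivAt F (f y) y)
    (hf : Continuous f) (h0 : F 0 = 0) (hl : Tendsto F atTop (𝓝 l)) : HasImproperIntegral f l := by
  refine ⟨fun R _ => hf.intervalIntegrable _ _, hl.congr fun R => ?_⟩
  rw [intervalIntegral.integral_eq_sub_of_hasDerivAt (fun y _ => hF y) (hf.intervalIntegrable _ _),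
    h0, sub_zero]

/-- Green's formula for the radial Laplacian against `J₀(ty)`, an eigenfunction for `-t²`. -/
theorem HasImproperIntegral.of_radial_laplacian {f f₁ f₂ : ℝ → ℝ} {t v : ℝ} (ht : 0 < t)
    (hf : ∀ y, HasDerivAt f (f₁ y) y) (hf₁ : ∀ y, HasDerivAt (fun y => y * f₁ y) (-(y * f₂ y)) y)
    (hf₂ : Continuous f₂) (hl : Tendsto (fun y => y * f y * besselJ0' (t * y)) atTop (𝓝 0))
    (hl₁ : Tendsto (fun y => y * f₁ y) atTop (𝓝 0))
    (h : HasImproperIntegral (fun y => y * f₂ y * besselJ0 (t * y)) v) :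
    HasImproperIntegral (fun y => y * f y * besselJ0 (t * y)) (v / t ^ 2) := by
  have hfc : Continuous f := continuous_iff_continuousAt.2 fun y => (hf y).continuousAt
  have hJ : Continuous fun y => (besselJ0 (t * y) : ℝ) :=
    continuous_besselJ0.comp (continuous_const.mul continuous_id)
  -- The Wronskian flux of `f` and `J₀(ty)`, divided by `t²`: the cross terms `y f₁ J₀'` cancel.
  have hd : ∀ y, HasDerivAt (fun y => (y * f₁ y) * besselJ0 (t * y) / t ^ 2 -
      f y * ((t * y) * besselJ0' (t * y)) / t ^ 2)
      (y * f y * besselJ0 (t * y) - (1 / t ^ 2) * (y * f₂ y * besselJ0 (t * y))) y := by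
    intro y
    have hty : HasDerivAt (fun y : ℝ => t * y) t y := by
      simpa using (hasDerivAt_id' y).const_mul t
    have hJ0 : HasDerivAt (fun y : ℝ => (besselJ0 (t * y) : ℝ)) (besselJ0' (t * y) * t) y :=
      (hasDerivAt_besselJ0 (t * y)).comp y hty
    have hJ1 : HasDerivAt (fun y : ℝ => (t * y) * besselJ0' (t * y))
        (-((t * y) * besselJ0 (t * y)) * t) y :=
      (hasDerivAt_mul_besselJ0' (t * y)).comp y hty
    refine ((((hf₁ y).fun_mul hJ0).div_const (t ^ 2)).fun_sub
      (((hf y).fun_mul hJ1).div_const (t ^ 2))).congr_deriv ?_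
    field_simp
    ring
  have hlim : Tendsto (fun y => (y * f₁ y) * besselJ0 (t * y) / t ^ 2 -
      f y * ((t * y) * besselJ0' (t * y)) / t ^ 2) atTop (𝓝 0) := by
    have h1 : Tendsto (fun y => (y * f₁ y) * besselJ0 (t * y)) atTop (𝓝 0) := by
      refine squeeze_zero_norm' ?_ (tendsto_norm_zero.comp hl₁)
      filter_upwards [eventually_ge_atTop 0] with y hy
      exact abs_mul_besselJ0_le _ (by positivity) le_rfl
    have := (h1.div_const (t ^ 2)).sub (hl.div_const t)
    simp only [zero_div, sub_zero] at this
    refine this.congr fun y => ?_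
    field_simp
  have hI := hasImproperIntegral_of_hasDerivAt hd
    (((continuous_id.mul hfc).mul hJ).sub (continuous_const.mul ((continuous_id.mul hf₂).mul hJ)))
    (by simp) hlim
  exact (hI.add (h.const_mul (1 / t ^ 2))).congr (by funext y; ring) (by ring)

theorem hasDerivAt_inv_dist (z y : ℝ) (hz : 0 < z) :
    HasDerivAt (fun y => 1 / Real.sqrt (z ^ 2 + y ^ 2))
      (-y / (Real.sqrt (z ^ 2 + y ^ 2) * (z ^ 2 + y ^ 2))) y := by
  have hρ : 0 < z ^ 2 + y ^ 2 := by positivity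
  have hs0 : 0 < Real.sqrt (z ^ 2 + y ^ 2) := Real.sqrt_pos.2 hρ
  have hsq : Real.sqrt (z ^ 2 + y ^ 2) ^ 2 = z ^ 2 + y ^ 2 := Real.sq_sqrt hρ.le
  have hr : HasDerivAt (fun y : ℝ => z ^ 2 + y ^ 2) (2 * y) y := by
    simpa using (hasDerivAt_pow 2 y).const_add (z ^ 2)
  refine ((hasDerivAt_const y (1 : ℝ)).fun_div (hr.sqrt hρ.ne') hs0.ne').congr_deriv ?_
  rw [hsq]
  field_simp
  ring

theorem tendsto_of_abs_le_div {f : ℝ → ℝ} (C : ℝ) (h : ∀ y, 1 ≤ y → |f y| ≤ C / y) :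
    Tendsto f atTop (𝓝 0) := by
  refine squeeze_zero_norm' ?_ ((tendsto_const_nhds (x := C)).div_atTop tendsto_id)
  filter_upwards [eventually_ge_atTop 1] with y hy
  exact h y hy

theorem le_sqrt_sq_add_sq (z y : ℝ) : y ≤ Real.sqrt (z ^ 2 + y ^ 2) :=
  Real.le_sqrt_of_sq_le (by nlinarith [sq_nonneg z])

/-- `(z²+y²)^{-1/2}` is harmonic in three dimensions, so minus its radial Laplacian in `y` is its
second `z`-derivative, `4 D₂`. Green's formula thus turns a conditionally convergent integral into
an absolutely convergent one. -/
theorem hasImproperIntegral_hankel_zero {t z : ℝ} (ht : 0 < t) (hz : 0 < z) :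
    HasImproperIntegral (fun y => y * invDistDeriv 0 z y * besselJ0 (t * y))
      (4 * hankelInvDist 2 t z / t ^ 2) := by
  have hρ : ∀ y : ℝ, 0 < z ^ 2 + y ^ 2 := fun y => by positivity
  simp only [invDistDeriv_zero]
  refine HasImproperIntegral.of_radial_laplacian ht (fun y => hasDerivAt_inv_dist z y hz)
    (f₂ := fun y => 4 * invDistDeriv 2 z y) ?_
    (continuous_const.mul (continuous_invDistDeriv_right 2 hz)) ?_ ?_ ?_
  · intro y
    have hs0 : 0 < Real.sqrt (z ^ 2 + y ^ 2) := Real.sqrt_pos.2 (hρ y)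
    have hsq : Real.sqrt (z ^ 2 + y ^ 2) ^ 2 = z ^ 2 + y ^ 2 := Real.sq_sqrt (hρ y).le
    have hr : HasDerivAt (fun y : ℝ => z ^ 2 + y ^ 2) (2 * y) y := by
      simpa using (hasDerivAt_pow 2 y).const_add (z ^ 2)
    refine ((hasDerivAt_id' y).fun_mul ((hasDerivAt_id' y).fun_neg.fun_div
      ((hr.sqrt (hρ y).ne').fun_mul hr) (mul_pos hs0 (hρ y)).ne')).congr_deriv ?_
    have hρ' := (hρ y).ne'
    rw [invDistDeriv, legendreHom_two]
    field_simp
    rw [hsq]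
    ring
  -- Here `y f(y)` tends to `1`, so the boundary term vanishes only because `J₀'` decays.
  · have h1 : Tendsto (fun y => besselJ0' (t * y)) atTop (𝓝 0) :=
      tendsto_besselJ0'_atTop.comp (tendsto_id.const_mul_atTop ht)
    refine squeeze_zero_norm' ?_ (tendsto_norm_zero.comp h1)
    filter_upwards [eventually_ge_atTop 0] with y hy
    rw [norm_mul]
    refine mul_le_of_le_one_left (norm_nonneg _) ?_
    rw [Real.norm_of_nonneg (by positivity), mul_one_div]
    exact div_le_one_of_le₀ (le_sqrt_sq_add_sq z y) (Real.sqrt_nonneg _)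
  · refine tendsto_of_abs_le_div 1 fun y hy => ?_
    have hy0 : 0 < y := by linarith
    have h1 := le_sqrt_sq_add_sq z y
    rw [abs_mul, abs_div, abs_neg, abs_of_pos hy0, abs_of_pos (mul_pos (hy0.trans_le h1) (hρ y)),
      ← mul_div_assoc, div_le_div_iff₀ (mul_pos (hy0.trans_le h1) (hρ y)) hy0]
    nlinarith [mul_le_mul h1 (show y * y ≤ z ^ 2 + y ^ 2 by nlinarith [sq_nonneg z]) (by positivity)
      (Real.sqrt_nonneg _)]
  · have := (hasImproperIntegral_of_integrableOn (integrableOn_hankelInvDist 1 ht hz)).const_mul 4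
    exact this.congr (by funext y; ring) rfl

/-- The same harmonicity after one `z`-derivative; `36 = 4 · 9` is the product of the factors
`(n+1)²` from two further derivatives. Comparison with the absolutely convergent integral yields
`M'' = t²M` for `M = hankelInvDist 1 t`. -/
theorem hasImproperIntegral_hankel_one {t z : ℝ} (ht : 0 < t) (hz : 0 < z) :
    HasImproperIntegral (fun y => y * invDistDeriv 1 z y * besselJ0 (t * y))
      (36 * hankelInvDist 3 t z / t ^ 2) := by
  have hρ : ∀ y : ℝ, 0 < z ^ 2 + y ^ 2 := fun y => by positivity
  have hs0 : ∀ y : ℝ, 0 < Real.sqrt (z ^ 2 + y ^ 2) := fun y => Real.sqrt_pos.2 (hρ y)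
  have hsq : ∀ y : ℝ, Real.sqrt (z ^ 2 + y ^ 2) ^ 2 = z ^ 2 + y ^ 2 := fun y =>
    Real.sq_sqrt (hρ y).le
  have hr : ∀ y, HasDerivAt (fun y : ℝ => z ^ 2 + y ^ 2) (2 * y) y := fun y => by
      simpa using (hasDerivAt_pow 2 y).const_add (z ^ 2)
  simp only [invDistDeriv_one]
  refine HasImproperIntegral.of_radial_laplacian ht
    (f₁ := fun y => -3 * z * y / (Real.sqrt (z ^ 2 + y ^ 2) * (z ^ 2 + y ^ 2) ^ 2))
    (f₂ := fun y => 36 * invDistDeriv 3 z y) ?_ ?_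
    (continuous_const.mul (continuous_invDistDeriv_right 3 hz)) ?_ ?_ ?_
  · intro y
    have h1 := hs0 y
    have h2 := hρ y
    have h3 := hsq y
    refine ((hasDerivAt_const y z).fun_div (((hr y).sqrt (hρ y).ne').fun_mul (hr y))
      (mul_pos h1 h2).ne').congr_deriv ?_
    field_simp
    rw [h3]
    ring
  · intro y
    have h1 := hs0 y
    have h2 := (hρ y).ne'
    have h3 := hsq y
    refine ((hasDerivAt_id' y).fun_mul (((hasDerivAt_id' y).const_mul (-3 * z)).fun_div
      (((hr y).sqrt h2).fun_mul ((hr y).fun_pow 2)) (mul_pos h1 (pow_pos (hρ y) 2)).ne')).congr_deriv ?_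
    rw [invDistDeriv, legendreHom_three]
    field_simp
    rw [h3]
    ring
  · refine tendsto_of_abs_le_div z fun y hy => ?_
    have hy0 : 0 < y := by linarith
    have h1 := le_sqrt_sq_add_sq z y
    have h2 : y ^ 2 ≤ z ^ 2 + y ^ 2 := by nlinarith [sq_nonneg z]
    rw [abs_mul, abs_of_pos (mul_pos hy0 (div_pos hz (mul_pos (hs0 y) (hρ y))))]
    calc y * (z / (Real.sqrt (z ^ 2 + y ^ 2) * (z ^ 2 + y ^ 2))) * |besselJ0' (t * y)|
        ≤ y * (z / (y * y ^ 2)) * 1 := by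
          gcongr
          exact abs_besselJ0'_le (by positivity)
      _ = z / y * (1 / y) := by field_simp
      _ ≤ z / y * 1 := by
          gcongr
          exact (div_le_one hy0).2 hy
      _ = z / y := mul_one _
  · refine tendsto_of_abs_le_div (3 * z) fun y hy => ?_
    have hy0 : 0 < y := by linarith
    have h1 := le_sqrt_sq_add_sq z y
    have h2 : y ^ 2 ≤ z ^ 2 + y ^ 2 := by nlinarith [sq_nonneg z]
    rw [show y * (-3 * z * y / (Real.sqrt (z ^ 2 + y ^ 2) * (z ^ 2 + y ^ 2) ^ 2)) =
      -(y * (3 * z * y / (Real.sqrt (z ^ 2 + y ^ 2) * (z ^ 2 + y ^ 2) ^ 2))) by ring, abs_neg,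
      abs_of_pos (mul_pos hy0 (div_pos (by positivity) (mul_pos (hs0 y) (pow_pos (hρ y) 2))))]
    calc y * (3 * z * y / (Real.sqrt (z ^ 2 + y ^ 2) * (z ^ 2 + y ^ 2) ^ 2))
        ≤ y * (3 * z * y / (y * (y ^ 2) ^ 2)) := by gcongr
      _ = 3 * z / y * (1 / y ^ 2) := by field_simp
      _ ≤ 3 * z / y * 1 := by
          gcongr
          exact (div_le_one (by positivity)).2 (by nlinarith)
      _ = 3 * z / y := mul_one _
  · have := (hasImproperIntegral_of_integrableOn (integrableOn_hankelInvDist 2 ht hz)).const_mul 36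
    exact this.congr (by funext y; ring) rfl

theorem sq_mul_hankelInvDist_one {t z : ℝ} (ht : 0 < t) (hz : 0 < z) :
    36 * hankelInvDist 3 t z = t ^ 2 * hankelInvDist 1 t z := by
  have := (hasImproperIntegral_hankel_one ht hz).unique
    (hasImproperIntegral_of_integrableOn (integrableOn_hankelInvDist 0 ht hz))
  rw [div_eq_iff (by positivity)] at this
  rw [this, mul_comm]
  rfl

theorem integral_mul_invDistDeriv_one {z : ℝ} (hz : 0 < z) :
    IntegrableOn (fun y => y * invDistDeriv 1 z y) (Set.Ioi 0) ∧
      ∫ y in Set.Ioi (0 : ℝ), y * invDistDeriv 1 z y = 1 := by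
  have hi : IntegrableOn (fun y => y * invDistDeriv 1 z y) (Set.Ioi 0) :=
    integrableOn_of_abs_le_div (continuous_id.mul (continuous_invDistDeriv_right 1 hz)) fun y hy =>
      abs_mul_invDistDeriv_one_le hz hy.le
  refine ⟨hi, ?_⟩
  have hd : ∀ y, HasDerivAt (fun y => -z * (1 / Real.sqrt (z ^ 2 + y ^ 2)))
      (y * invDistDeriv 1 z y) y := fun y =>
    ((hasDerivAt_inv_dist z y hz).const_mul (-z)).congr_deriv (by rw [invDistDeriv_one]; ring)
  have hl : Tendsto (fun y => -z * (1 / Real.sqrt (z ^ 2 + y ^ 2))) atTop (𝓝 0) := by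
    have : Tendsto (fun y => Real.sqrt (z ^ 2 + y ^ 2)) atTop atTop :=
      tendsto_atTop_mono (le_sqrt_sq_add_sq z) tendsto_id
    simpa using (tendsto_const_nhds (x := (1 : ℝ)).div_atTop this).const_mul (-z)
  rw [integral_Ioi_of_hasDerivAt_of_tendsto (hd 0).continuousAt.continuousWithinAt
    (fun y _ => hd y) hi hl]
  simp [Real.sqrt_sq hz.le, hz.ne']

theorem abs_hankelInvDist_one_le {t z : ℝ} (ht : 0 < t) (hz : 0 < z) :
    |hankelInvDist 1 t z| ≤ 1 := by
  obtain ⟨hi, h1⟩ := integral_mul_invDistDeriv_one hz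
  rw [← h1, ← Real.norm_eq_abs, hankelInvDist]
  refine norm_integral_le_of_norm_le hi ?_
  filter_upwards [ae_restrict_mem measurableSet_Ioi] with y hy
  have hy : 0 < y := hy
  refine abs_mul_besselJ0_le _ (by positivity) (abs_of_nonneg ?_).le
  rw [invDistDeriv_one]
  positivity

/-- The scaling `y = zw` moves `z` out of the singular kernel and into `J₀`, where `z → 0+` is
harmless. -/
theorem hankelInvDist_one_eq {t z : ℝ} (hz : 0 < z) :
    hankelInvDist 1 t z =
      ∫ w in Set.Ioi (0 : ℝ), w * invDistDeriv 1 1 w * besselJ0 (t * (z * w)) := by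
  have := integral_comp_mul_left_Ioi (fun y => y * invDistDeriv 1 z y * besselJ0 (t * y)) 0 hz
  rw [mul_zero, smul_eq_mul, eq_inv_mul_iff_mul_eq₀ hz.ne', ← integral_const_mul] at this
  rw [hankelInvDist, ← this]
  congr 1
  funext w
  have e : z ^ 2 + (z * w) ^ 2 = z ^ 2 * (1 ^ 2 + w ^ 2) := by ring
  have h1 : 0 < 1 ^ 2 + w ^ 2 := by positivity
  have h2 : Real.sqrt (1 ^ 2 + w ^ 2) ≠ 0 := (Real.sqrt_pos.2 h1).ne'
  rw [invDistDeriv_one, invDistDeriv_one, e, Real.sqrt_mul (by positivity), Real.sqrt_sq hz.le]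
  field_simp

theorem tendsto_hankelInvDist_one {t : ℝ} (ht : 0 < t) :
    Tendsto (hankelInvDist 1 t) (𝓝[>] 0) (𝓝 1) := by
  obtain ⟨hi, h1⟩ := integral_mul_invDistDeriv_one one_pos
  have hc : ∀ z : ℝ, Continuous fun w => w * invDistDeriv 1 1 w * besselJ0 (t * (z * w)) := fun z =>
    (continuous_id.mul (continuous_invDistDeriv_right 1 one_pos)).mul
      (continuous_besselJ0.comp (by fun_prop))
  have key : Tendsto (fun z => ∫ w in Set.Ioi (0 : ℝ),
      w * invDistDeriv 1 1 w * besselJ0 (t * (z * w))) (𝓝[>] 0)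
      (𝓝 (∫ w in Set.Ioi (0 : ℝ), w * invDistDeriv 1 1 w)) := by
    refine tendsto_integral_filter_of_dominated_convergence (fun w => w * invDistDeriv 1 1 w)
      (Eventually.of_forall fun z => (hc z).aestronglyMeasurable) ?_ hi ?_
    · filter_upwards [self_mem_nhdsWithin] with z hz
      have hz : 0 < z := hz
      filter_upwards [ae_restrict_mem measurableSet_Ioi] with w hw
      have hw : 0 < w := hw
      refine abs_mul_besselJ0_le _ (by positivity) (abs_of_nonneg ?_).le
      rw [invDistDeriv_one]
      positivity
    · refine Eventually.of_forall fun w => ?_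
      have : Continuous fun z => w * invDistDeriv 1 1 w * besselJ0 (t * (z * w)) :=
        continuous_const.mul (continuous_besselJ0.comp (by fun_prop))
      have h := (this.tendsto 0).mono_left (nhdsWithin_le_nhds (s := Set.Ioi 0))
      simpa [besselJ0_zero] using h
  rw [h1] at key
  refine key.congr' ?_
  filter_upwards [self_mem_nhdsWithin] with z hz
  exact (hankelInvDist_one_eq hz).symm

theorem exists_abs_hankelInvDist_two_le {t : ℝ} (ht : 0 < t) :
    ∃ C, ∀ z, 1 ≤ z → |hankelInvDist 2 t z| ≤ C := by
  refine ⟨∫ y in Set.Ioi (0 : ℝ), 2 ^ (0 + 2) / ((0 + 2).factorial : ℝ) *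
    ((1 + 1 / 1 ^ 2) / 1 ^ 0) * (1 + y ^ 2)⁻¹, fun z hz => ?_⟩
  rw [← Real.norm_eq_abs, hankelInvDist]
  refine norm_integral_le_of_norm_le (integrable_inv_one_add_sq.integrableOn.const_mul _) ?_
  · filter_upwards [ae_restrict_mem measurableSet_Ioi] with y hy
    have hy : 0 < y := hy
    exact abs_mul_besselJ0_le _ (by positivity) (abs_mul_invDistDeriv_le 0 one_pos hz hy.le)

/-- `M'' = t²M` forces a bounded `M` with `M(0+) = 1` to be `e^{-tz}`. -/
theorem hankelInvDist_one {t z : ℝ} (ht : 0 < t) (hz : 0 < z) :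
    hankelInvDist 1 t z = Real.exp (-t * z) := by
  have d1 : ∀ z, 0 < z → HasDerivAt (hankelInvDist 1 t) (-4 * hankelInvDist 2 t z) z := fun z hz =>
    (hasDerivAt_hankelInvDist 0 ht hz).congr_deriv (by push_cast; ring)
  have d2 : ∀ z, 0 < z → HasDerivAt (hankelInvDist 2 t) (-9 * hankelInvDist 3 t z) z := fun z hz =>
    (hasDerivAt_hankelInvDist 1 ht hz).congr_deriv (by push_cast; ring)
  have dexp : ∀ (c z : ℝ), HasDerivAt (fun z => Real.exp (c * z)) (c * Real.exp (c * z)) z :=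
    fun c z => by
      have : HasDerivAt (fun z : ℝ => c * z) c z := by simpa using (hasDerivAt_id' z).const_mul c
      exact this.exp.congr_deriv (mul_comm _ _)
  have hconst : ∀ {g : ℝ → ℝ}, (∀ z, 0 < z → HasDerivAt g 0 z) → ∀ {x y : ℝ}, 0 < x → 0 < y →
      g x = g y := fun hg _ _ hx hy =>
    isOpen_Ioi.is_const_of_deriv_eq_zero isPreconnected_Ioi
      (fun z hz => (hg z hz).differentiableAt.differentiableWithinAt) (fun z hz => (hg z hz).deriv) hx hy
  -- With `M = hankelInvDist 1 t`, this is `e^{-tz}(M' + tM)`: constant because `M'' = t²M`, and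
  -- zero because `M` and `M'` are bounded for `z ≥ 1`. This excludes the growing solution.
  have hA : ∀ z, 0 < z → Real.exp (-t * z) * (-4 * hankelInvDist 2 t z + t * hankelInvDist 1 t z) = 0 := by
    intro z hz
    have hlim : Tendsto (fun z => Real.exp (-t * z) *
        (-4 * hankelInvDist 2 t z + t * hankelInvDist 1 t z)) atTop (𝓝 0) := by
      obtain ⟨C, hC⟩ := exists_abs_hankelInvDist_two_le ht
      have he : Tendsto (fun z => Real.exp (-t * z) * (4 * C + t)) atTop (𝓝 0) := by
        have := (Real.tendsto_exp_atBot.comp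
          (tendsto_id.const_mul_atTop_of_neg (neg_lt_zero.2 ht))).mul_const (4 * C + t)
        simpa using this
      refine squeeze_zero_norm' ?_ he
      filter_upwards [eventually_ge_atTop 1] with z hz
      rw [norm_mul, Real.norm_of_nonneg (Real.exp_pos _).le]
      gcongr
      refine (norm_add_le _ _).trans ?_
      rw [norm_mul, norm_mul, Real.norm_of_nonneg ht.le]
      have h1 := hC z hz
      have h2 := abs_hankelInvDist_one_le ht (one_pos.trans_le hz)
      have : ‖(-4 : ℝ)‖ = 4 := by norm_num
      rw [this]
      refine add_le_add (mul_le_mul_of_nonneg_left h1 (by norm_num)) ?_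
      exact (mul_le_mul_of_nonneg_left h2 ht.le).trans_eq (mul_one t)
    have hd : ∀ z, 0 < z → HasDerivAt (fun z => Real.exp (-t * z) *
        (-4 * hankelInvDist 2 t z + t * hankelInvDist 1 t z)) 0 z := by
      intro z hz
      refine ((dexp (-t) z).fun_mul (((d2 z hz).const_mul (-4)).fun_add
        ((d1 z hz).const_mul t))).congr_deriv ?_
      linear_combination Real.exp (-t * z) * sq_mul_hankelInvDist_one ht hz
    refine tendsto_nhds_unique (tendsto_const_nhds.congr' ?_) hlim
    filter_upwards [eventually_gt_atTop 0] with w hw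
    exact hconst hd hz hw
  -- Now `M' = -tM`, so `e^{tz} M` is constant and equals its limit at `0+`.
  have hB : ∀ z, 0 < z → HasDerivAt (fun z => Real.exp (t * z) * hankelInvDist 1 t z) 0 z := by
    intro z hz
    refine ((dexp t z).fun_mul (d1 z hz)).congr_deriv ?_
    have := (mul_eq_zero.1 (hA z hz)).resolve_left (Real.exp_pos _).ne'
    linear_combination Real.exp (t * z) * this
  have hlim : Tendsto (fun z => Real.exp (t * z) * hankelInvDist 1 t z) (𝓝[>] 0) (𝓝 1) := by
    have h1 : Tendsto (fun z => Real.exp (t * z)) (𝓝[>] 0) (𝓝 1) := by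
      have := (by fun_prop : Continuous fun z : ℝ => Real.exp (t * z)).tendsto 0
      simpa using this.mono_left (nhdsWithin_le_nhds (s := Set.Ioi 0))
    simpa using h1.mul (tendsto_hankelInvDist_one ht)
  have h1 : Real.exp (t * z) * hankelInvDist 1 t z = 1 := by
    refine tendsto_nhds_unique (tendsto_const_nhds.congr' ?_) hlim
    filter_upwards [self_mem_nhdsWithin] with w hw
    exact hconst hB hz hw
  rw [neg_mul, Real.exp_neg]
  exact eq_inv_of_mul_eq_one_right h1

theorem hankelInvDist_succ {t : ℝ} (ht : 0 < t) (n : ℕ) :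
    ∀ z, 0 < z → hankelInvDist (n + 1) t z =
      t ^ n * Real.exp (-t * z) / ((n + 1).factorial : ℝ) ^ 2 := by
  induction n with
  | zero => intro z hz; simp [hankelInvDist_one ht hz]
  | succ n ih =>
    intro z hz
    have h1 := hasDerivAt_hankelInvDist n ht hz
    have h2 : HasDerivAt (fun z => t ^ n * Real.exp (-t * z) / ((n + 1).factorial : ℝ) ^ 2)
        (t ^ n * (Real.exp (-t * z) * (-t)) / ((n + 1).factorial : ℝ) ^ 2) z := by
      have : HasDerivAt (fun z : ℝ => -t * z) (-t) z := by
        simpa using (hasDerivAt_id' z).const_mul (-t)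
      exact (this.exp.const_mul _).div_const _
    have h3 := h1.unique (h2.congr_of_eventuallyEq
      (eventually_of_mem (Ioi_mem_nhds hz) fun w hw => ih w hw))
    rw [show n + 1 + 1 = n + 2 by ring, Nat.factorial_succ]
    push_cast
    have : (n : ℝ) + 2 ≠ 0 := by positivity
    have : (n : ℝ) + 1 + 1 ≠ 0 := by positivity
    have h4 : hankelInvDist (n + 2) t z = -(t ^ n * (Real.exp (-t * z) * (-t)) /
        ((n + 1).factorial : ℝ) ^ 2) / ((n : ℝ) + 2) ^ 2 := by
      rw [← h3]; field_simp
    rw [h4]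
    field_simp
    ring

theorem hasImproperIntegral_mul_invDistDeriv_mul_besselJ0 {t : ℝ} (ht : 0 < t) (n : ℕ) :
    HasImproperIntegral (fun y => y * invDistDeriv n 1 y * besselJ0 (t * y))
      (t ^ n / (n.factorial : ℝ) ^ 2 * (Real.exp (-t) / t)) := by
  cases n with
  | zero =>
    refine (hasImproperIntegral_hankel_zero ht one_pos).congr rfl ?_
    rw [hankelInvDist_succ ht 1 1 one_pos]
    simp [Nat.factorial]
    field_simp
    norm_num
  | succ n =>
    refine (hasImproperIntegral_of_integrableOn (integrableOn_hankelInvDist n ht one_pos)).congr rfl ?_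
    have := hankelInvDist_succ ht n 1 one_pos
    rw [hankelInvDist] at this
    rw [this, mul_one]
    field_simp
    ring

/-! ### Power series of the Kelvin functions and the generating functions of the kernels. -/

theorem HasSum.congr_terms {α E : Type*} [AddCommMonoid E] [TopologicalSpace E] {f g : α → E}
    {v w : E} (h : HasSum f v) (hfg : ∀ n, f n = g n) (hvw : v = w) : HasSum g w :=
  funext hfg ▸ hvw ▸ h

theorem besselJ0_ofReal (x : ℝ) : besselJ0 (x : ℂ) = ((besselJ0 x : ℝ) : ℂ) := by
  simp only [besselJ0, Complex.ofReal_tsum]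
  push_cast
  rfl

theorem besselJ0_mul_I (x : ℝ) : besselJ0 ((x : ℂ) * Complex.I) = (besselI0 x : ℂ) := by
  simp only [besselJ0, besselI0, Complex.ofReal_tsum]
  refine tsum_congr fun k => ?_
  push_cast
  congr 1
  rw [mul_div_right_comm, mul_pow, pow_mul Complex.I, Complex.I_sq, mul_left_comm, ← mul_pow]
  norm_num

theorem besselJ0_neg (x : ℝ) : (besselJ0 (-x) : ℝ) = besselJ0 x := by
  simp only [besselJ0, neg_div, Even.neg_pow (even_two_mul _)]

theorem I_pow_eq (n : ℕ) : Complex.I ^ n =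
    (Real.cos (n * (Real.pi / 2)) : ℂ) + (Real.sin (n * (Real.pi / 2)) : ℂ) * Complex.I := by
  rw [Complex.ofReal_cos, Complex.ofReal_sin, ← Complex.exp_mul_I]
  push_cast
  rw [mul_assoc, Complex.exp_nat_mul, Complex.exp_pi_div_two_mul_I]

theorem re_I_pow (n : ℕ) : (Complex.I ^ n).re = Real.cos (n * (Real.pi / 2)) := by
  rw [I_pow_eq, Complex.add_re, Complex.re_ofReal_mul, Complex.ofReal_re, Complex.I_re, mul_zero,
    add_zero]

theorem im_I_pow (n : ℕ) : (Complex.I ^ n).im = Real.sin (n * (Real.pi / 2)) := by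
  rw [I_pow_eq, Complex.add_im, Complex.im_ofReal_mul, Complex.ofReal_im, Complex.I_im, mul_one,
    zero_add]

/-- Since `(e^{3πi/4})² = -i`, the series variable `-(z/2)²` of `J₀` becomes `i x²/4`. -/
theorem hasSum_kelvin (x : ℝ) :
    HasSum (fun n : ℕ => Complex.I ^ n * (((x ^ 2 / 4) ^ n / (n.factorial : ℝ) ^ 2 : ℝ) : ℂ))
      (besselJ0 ((x : ℂ) * Complex.exp (3 * (Real.pi : ℂ) * Complex.I / 4))) := by
  have h : Complex.exp (3 * (Real.pi : ℂ) * Complex.I / 4) ^ 2 = -Complex.I := by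
    rw [← Complex.exp_nat_mul, show ((2 : ℕ) : ℂ) * (3 * (Real.pi : ℂ) * Complex.I / 4) =
      (Real.pi : ℂ) * Complex.I + (Real.pi : ℂ) / 2 * Complex.I by push_cast; ring, Complex.exp_add,
      Complex.exp_pi_mul_I, Complex.exp_pi_div_two_mul_I]
    ring
  refine (hasSum_besselJ0_even _).congr_terms (fun n => ?_) rfl
  rw [pow_mul, div_pow, mul_pow, h, ← mul_pow]
  push_cast
  rw [← mul_div_assoc (Complex.I ^ n), ← mul_pow]
  congr 2
  ring

theorem hasSum_kelvinBer (x : ℝ) :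
    HasSum (fun n : ℕ => Real.cos (n * (Real.pi / 2)) * ((x ^ 2 / 4) ^ n / (n.factorial : ℝ) ^ 2))
      (kelvinBer x) := by
  refine (Complex.reCLM.hasSum (hasSum_kelvin x)).congr_terms (fun n => ?_) rfl
  rw [Complex.reCLM_apply, Complex.re_mul_ofReal, re_I_pow]

theorem hasSum_kelvinBei (x : ℝ) :
    HasSum (fun n : ℕ => Real.sin (n * (Real.pi / 2)) * ((x ^ 2 / 4) ^ n / (n.factorial : ℝ) ^ 2))
      (kelvinBei x) := by
  refine (Complex.imCLM.hasSum (hasSum_kelvin x)).congr_terms (fun n => ?_) rfl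
  rw [Complex.imCLM_apply, Complex.im_mul_ofReal, im_I_pow]

/-- The series of `e^{us} J₀(vs)` at `s = r/(u²+v²)`. A complex `r` is allowed so that `r = ic`
turns `J₀` into `I₀`. -/
theorem hasSum_invDistDeriv (u v : ℝ) (r : ℂ) :
    HasSum (fun n => r ^ n * (invDistDeriv n u v : ℂ))
      ((1 / Real.sqrt (u ^ 2 + v ^ 2) : ℝ) * (Complex.exp (u * (r / (u ^ 2 + v ^ 2 : ℝ))) *
        besselJ0 ((v : ℂ) * (r / (u ^ 2 + v ^ 2 : ℝ))))) := by
  refine ((hasSum_legendreHom u v (r / (u ^ 2 + v ^ 2 : ℝ))).mul_left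
    ((1 / Real.sqrt (u ^ 2 + v ^ 2) : ℝ) : ℂ)).congr_terms (fun n => ?_) rfl
  rw [invDistDeriv]
  push_cast
  rw [div_pow, one_div, div_eq_mul_inv, div_eq_mul_inv, mul_inv]
  ring

theorem hasSum_pow_mul_invDistDeriv (u v c : ℝ) :
    HasSum (fun n => c ^ n * invDistDeriv n u v)
      (1 / Real.sqrt (u ^ 2 + v ^ 2) * (Real.exp (u * (c / (u ^ 2 + v ^ 2))) *
        besselJ0 (v * (c / (u ^ 2 + v ^ 2))))) := by
  rw [← Complex.hasSum_ofReal]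
  have := hasSum_invDistDeriv u v c
  push_cast [← besselJ0_ofReal]
  exact_mod_cast this

theorem hasSum_I_pow_mul_invDistDeriv (u v c : ℝ) :
    HasSum (fun n => Complex.I ^ n * ((c ^ n * invDistDeriv n u v : ℝ) : ℂ))
      ((1 / Real.sqrt (u ^ 2 + v ^ 2) * besselI0 (v * (c / (u ^ 2 + v ^ 2))) : ℝ) *
        Complex.exp ((u * (c / (u ^ 2 + v ^ 2)) : ℝ) * Complex.I)) := by
  refine (hasSum_invDistDeriv u v (c * Complex.I)).congr_terms (fun n => ?_) ?_
  · push_cast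
    ring
  · have e1 : (v : ℂ) * (c * Complex.I / (u ^ 2 + v ^ 2 : ℝ)) =
        ((v * (c / (u ^ 2 + v ^ 2)) : ℝ) : ℂ) * Complex.I := by push_cast; ring
    have e2 : (u : ℂ) * (c * Complex.I / (u ^ 2 + v ^ 2 : ℝ)) =
        ((u * (c / (u ^ 2 + v ^ 2)) : ℝ) : ℂ) * Complex.I := by push_cast; ring
    rw [e1, e2, besselJ0_mul_I]
    push_cast
    ring

/-! ### Summation of the transforms and the four formulas. -/

/-- Common to all four formulas: `K` is `K₀(t)` or `e^{-t}/t`, and `e n` is `cos(nπ/2)` or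
`sin(nπ/2)`. -/
theorem hasImproperIntegral_series {g : ℕ → ℝ → ℝ} {t K : ℝ}
    (hg : ∀ n, HasImproperIntegral (g n) (t ^ n / (n.factorial : ℝ) ^ 2 * K))
    (hgc : ∀ n, Continuous (g n))
    (hgb : ∀ n y, 0 < y → |g (n + 1) y| ≤
      2 ^ (n + 1) / ((n + 1).factorial : ℝ) * 2 * (1 + y ^ 2)⁻¹)
    {e : ℕ → ℝ} (he : ∀ n, |e n| ≤ 1) {c : ℝ} {F : ℝ → ℝ}
    (hF : ∀ y, 0 < y → HasSum (fun n => e n * (c ^ n * g n y)) (F y)) {V : ℝ}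
    (hV : HasSum (fun n => e n * ((c * t) ^ n / (n.factorial : ℝ) ^ 2)) V) :
    HasImproperIntegral F (K * V) := by
  refine hasImproperIntegral_of_hasSum (f := fun n y => e n * (c ^ n * g n y))
    (v := fun n => K * (e n * ((c * t) ^ n / (n.factorial : ℝ) ^ 2)))
    (b := fun n => (2 * |c|) ^ (n + 1) / ((n + 1).factorial : ℝ) * 2) hF (hV.mul_left K)
    (fun n => ?_) (fun n => ?_) ?_ (fun n y hy => ?_)
  · refine (((hg n).const_mul (c ^ n)).const_mul (e n)).congr rfl ?_
    rw [mul_pow]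
    ring
  · exact continuous_const.mul (continuous_const.mul (hgc _))
  · exact ((summable_nat_add_iff 1).2 (Real.summable_pow_div_factorial (2 * |c|))).mul_right 2
  · rw [abs_mul, abs_mul, abs_pow]
    calc |e (n + 1)| * (|c| ^ (n + 1) * |g (n + 1) y|)
        ≤ 1 * (|c| ^ (n + 1) * (2 ^ (n + 1) / ((n + 1).factorial : ℝ) * 2 * (1 + y ^ 2)⁻¹)) := by
          gcongr
          · exact he _
          · exact hgb n y hy
      _ = _ := by rw [mul_pow]; ring

/-- The factor `2` is slack here, matching the Hankel case, where it is `1 + 1/ε²` at `ε = 1`. -/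
theorem abs_invDistDeriv_succ_le (n : ℕ) (y : ℝ) :
    |invDistDeriv (n + 1) y 1| ≤ 2 ^ (n + 1) / ((n + 1).factorial : ℝ) * 2 * (1 + y ^ 2)⁻¹ := by
  have hρ : 0 < y ^ 2 + (1 : ℝ) ^ 2 := by positivity
  have hsq : Real.sqrt (y ^ 2 + 1 ^ 2) ^ 2 = y ^ 2 + 1 ^ 2 := Real.sq_sqrt hρ.le
  have h1 : 1 ≤ Real.sqrt (y ^ 2 + 1 ^ 2) := le_sqrt_sq_add_sq y 1
  refine (abs_invDistDeriv_le (n + 1) y 1 hρ).trans ?_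
  have h2 : 1 + y ^ 2 ≤ Real.sqrt (y ^ 2 + 1 ^ 2) ^ (n + 1 + 1) := by
    calc 1 + y ^ 2 = Real.sqrt (y ^ 2 + 1 ^ 2) ^ 2 := by rw [hsq]; ring
      _ ≤ _ := pow_le_pow_right₀ h1 (by omega)
  rw [← div_eq_mul_inv]
  gcongr
  have : 0 ≤ 2 ^ (n + 1) / ((n + 1).factorial : ℝ) := by positivity
  linarith

theorem abs_mul_invDistDeriv_succ_le (n : ℕ) {y : ℝ} (hy : 0 < y) :
    |y * invDistDeriv (n + 1) 1 y| ≤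
      2 ^ (n + 1) / ((n + 1).factorial : ℝ) * 2 * (1 + y ^ 2)⁻¹ := by
  cases n with
  | zero =>
    refine (abs_mul_invDistDeriv_one_le one_pos hy.le).trans ?_
    refine mul_le_mul_of_nonneg_right ?_ (by positivity)
    norm_num
  | succ n =>
    refine (abs_mul_invDistDeriv_le n one_pos le_rfl hy.le).trans (le_of_eq ?_)
    norm_num

theorem mainTheorem10 (a t : ℝ) (ht : 0 < t) :
    HasImproperIntegral
      (fun y : ℝ => 1 / Real.sqrt (1 + y ^ 2) * besselJ0 (a ^ 2 / (4 * (1 + y ^ 2))) *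
        Real.cosh (a ^ 2 * y / (4 * (1 + y ^ 2))) * Real.cos (t * y))
      (besselK0 t * kelvinBer (a * Real.sqrt t)) ∧
    HasImproperIntegral
      (fun y : ℝ => 1 / Real.sqrt (1 + y ^ 2) * besselJ0 (a ^ 2 / (4 * (1 + y ^ 2))) *
        Real.sinh (a ^ 2 * y / (4 * (1 + y ^ 2))) * Real.sin (t * y))
      (besselK0 t * kelvinBei (a * Real.sqrt t)) ∧
    HasImproperIntegral
      (fun y : ℝ => y / Real.sqrt (1 + y ^ 2) * besselI0 (a ^ 2 * y / (4 * (1 + y ^ 2))) *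
        Real.cos (a ^ 2 / (4 * (1 + y ^ 2))) * besselJ0 (t * y))
      (Real.exp (-t) * kelvinBer (a * Real.sqrt t) / t) ∧
    HasImproperIntegral
      (fun y : ℝ => y / Real.sqrt (1 + y ^ 2) * besselI0 (a ^ 2 * y / (4 * (1 + y ^ 2))) *
        Real.sin (a ^ 2 / (4 * (1 + y ^ 2))) * besselJ0 (t * y))
      (Real.exp (-t) * kelvinBei (a * Real.sqrt t) / t) := by
  set c : ℝ := a ^ 2 / 4 with hc
  have hx : (a * Real.sqrt t) ^ 2 / 4 = c * t := by
    rw [mul_pow, Real.sq_sqrt ht.le]; ring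
  have hber := hasSum_kelvinBer (a * Real.sqrt t)
  have hbei := hasSum_kelvinBei (a * Real.sqrt t)
  rw [hx] at hber hbei
  have hcos : ∀ n : ℕ, |Real.cos (n * (Real.pi / 2))| ≤ 1 := fun n => Real.abs_cos_le_one _
  have hsin : ∀ n : ℕ, |Real.sin (n * (Real.pi / 2))| ≤ 1 := fun n => Real.abs_sin_le_one _
  have e1 : ∀ y : ℝ, a ^ 2 / (4 * (1 + y ^ 2)) = c / (1 + y ^ 2) := fun y => by rw [hc, div_div]
  have e2 : ∀ y : ℝ, a ^ 2 * y / (4 * (1 + y ^ 2)) = y * (c / (1 + y ^ 2)) := fun y => by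
    rw [← e1]; ring
  simp only [e1, e2]
  have hAc : ∀ n : ℕ, Continuous fun y => invDistDeriv n y 1 * Real.cos (t * y - n * (Real.pi / 2)) :=
    fun n => (continuous_invDistDeriv_left n).mul (by fun_prop)
  have hAb : ∀ (n : ℕ) (y : ℝ), 0 < y →
      |invDistDeriv (n + 1) y 1 * Real.cos (t * y - (n + 1 : ℕ) * (Real.pi / 2))| ≤
      2 ^ (n + 1) / ((n + 1).factorial : ℝ) * 2 * (1 + y ^ 2)⁻¹ := fun n y _ => by
    rw [abs_mul]
    exact (mul_le_of_le_one_right (abs_nonneg _) (Real.abs_cos_le_one _)).trans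
      (abs_invDistDeriv_succ_le n y)
  have hBc : ∀ n : ℕ, Continuous fun y => y * invDistDeriv n 1 y * besselJ0 (t * y) := fun n =>
    continuous_hankelInvDist_integrand n t one_pos
  have hBb : ∀ (n : ℕ) (y : ℝ), 0 < y → |y * invDistDeriv (n + 1) 1 y * besselJ0 (t * y)| ≤
      2 ^ (n + 1) / ((n + 1).factorial : ℝ) * 2 * (1 + y ^ 2)⁻¹ := fun n y hy =>
    abs_mul_besselJ0_le _ (by positivity) (abs_mul_invDistDeriv_succ_le n hy)
  have hA := hasImproperIntegral_invDistDeriv_mul_cos ht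
  have hB := hasImproperIntegral_mul_invDistDeriv_mul_besselJ0 ht
  have hG : ∀ y d : ℝ, HasSum (fun n => d ^ n * invDistDeriv n y 1)
      (1 / Real.sqrt (1 + y ^ 2) * (Real.exp (y * (d / (1 + y ^ 2))) * besselJ0 (d / (1 + y ^ 2)))) := by
    intro y d
    have := hasSum_pow_mul_invDistDeriv y 1 d
    rwa [one_pow, add_comm (y ^ 2), one_mul] at this
  have hH : ∀ y : ℝ, HasSum (fun n => Complex.I ^ n * ((c ^ n * invDistDeriv n 1 y : ℝ) : ℂ))
      ((1 / Real.sqrt (1 + y ^ 2) * besselI0 (y * (c / (1 + y ^ 2))) : ℝ) *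
        Complex.exp ((c / (1 + y ^ 2) : ℝ) * Complex.I)) := by
    intro y
    have := hasSum_I_pow_mul_invDistDeriv 1 y c
    rwa [one_pow, one_mul] at this
  refine ⟨?_, ?_, ?_, ?_⟩
  · refine hasImproperIntegral_series hA hAc hAb hcos (c := c) (fun y _ => ?_) hber
    -- `cos(nπ/2) cos(ty - nπ/2) = cos(ty)(1 + (-1)ⁿ)/2`: the weight removes the phase and keeps
    -- even `n`, so averaging over `±c` gives `cosh`.
    refine (((hG y c).add (hG y (-c))).mul_left (Real.cos (t * y) / 2)).congr_terms (fun n => ?_) ?_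
    · have h := Real.two_mul_cos_mul_cos (t * y - n * (Real.pi / 2)) (n * (Real.pi / 2))
      rw [show t * y - n * (Real.pi / 2) - n * (Real.pi / 2) = t * y - n * Real.pi by ring,
        sub_add_cancel, Real.cos_sub_nat_mul_pi] at h
      rw [neg_pow c]
      linear_combination -(c ^ n * invDistDeriv n y 1 / 2) * h
    · rw [neg_div, besselJ0_neg, Real.cosh_eq, mul_neg]
      ring
  · refine hasImproperIntegral_series hA hAc hAb hsin (c := c) (fun y _ => ?_) hbei
    -- Likewise `sin(nπ/2) cos(ty - nπ/2) = sin(ty)(1 - (-1)ⁿ)/2` keeps odd `n` and gives `sinh`.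
    refine (((hG y c).sub (hG y (-c))).mul_left (Real.sin (t * y) / 2)).congr_terms (fun n => ?_) ?_
    · have h := Real.two_mul_sin_mul_cos (n * (Real.pi / 2)) (t * y - n * (Real.pi / 2))
      rw [show n * (Real.pi / 2) - (t * y - n * (Real.pi / 2)) = -(t * y - n * Real.pi) by ring,
        add_sub_cancel, Real.sin_neg, Real.sin_sub_nat_mul_pi] at h
      rw [neg_pow c]
      linear_combination -(c ^ n * invDistDeriv n y 1 / 2) * h
    · rw [neg_div, besselJ0_neg, Real.sinh_eq, mul_neg]
      ring
  · refine (hasImproperIntegral_series hB hBc hBb hcos (c := c) (fun y _ => ?_) hber).congr rfl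
      (by ring)
    refine ((Complex.reCLM.hasSum (hH y)).mul_left (y * besselJ0 (t * y))).congr_terms (fun n => ?_) ?_
    · rw [Complex.reCLM_apply, Complex.re_mul_ofReal, re_I_pow]
      ring
    · simp only [Complex.reCLM_apply, Complex.re_ofReal_mul, Complex.exp_ofReal_mul_I_re]
      ring
  · refine (hasImproperIntegral_series hB hBc hBb hsin (c := c) (fun y _ => ?_) hbei).congr rfl
      (by ring)
    refine ((Complex.imCLM.hasSum (hH y)).mul_left (y * besselJ0 (t * y))).congr_terms (fun n => ?_) ?_
    · rw [Complex.imCLM_apply, Complex.im_mul_ofReal, im_I_pow]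
      ring
    · simp only [Complex.imCLM_apply, Complex.im_ofReal_mul, Complex.exp_ofReal_mul_I_im]
      ring
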